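/- Let $\mathbb F_q$ be a finite field with $q$ elements, $A=\mathbb F_q[\theta]$, $K=\mathbb F_q(\theta)$, let $A_+$ be the set of monic elements of $A$ and $A_{+,d}$ the set of those of degree $d$. Let $s\ge 1$ be an integer, and let $t_1,\dots,t_s,z$ and $X_1,\dots,X_s,Z$ be indeterminates. Put $D_0=l_0=1$ and, for $i\ge 1$, $D_i=(\theta^{q^i}-\theta)D_{i-1}^q$ and $l_i=(\theta-\theta^{q^i})l_{i-1}$. On $K[t_1,\dots,t_s][[z]]$ let $\tau_z=z(t_1-\theta)\cdots(t_s-\theta)\varphi$, where $\varphi$ raises the coefficients in $K$ to the $q$-th power and fixes $t_1,\dots,t_s,z$, and let $\exp_z=\sum_{j\ge 0}\frac1{D_j}\tau_z^j$, $\log_z=\sum_{j\ge 0}\frac1{l_j}\tau_z^j$. Let $$L(1,s,z)=\sum_{d\ge 0}z^d\sum_{a\in A_{+,d}}\frac{a(t_1)\cdots a(t_s)}{a}\in K[t_1,\dots,t_s][[z]],\qquad \sigma_s(t,z)=\exp_z(L(1,s,z)).$$ On $Z K[X_1,\dots,X_s][[Z]]$ let $\exp_C(G)=\sum_{j\ge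 0}\frac{1}{D_j}G^{q^j}$ and $\log_C(G)=\sum_{j\ge 0}\frac1{l_j}G^{q^j}$. Let $C$ be the Carlitz module, i.e. the $\mathbb F_q$-algebra morphism $a\mapsto C_a$ with $C_\theta(Y)=\theta Y+Y^q$. For $a\in A\setminus\{0\}$ and $G\in K[X_1,\dots,X_s][[Z]]$ put $a*G=G(C_a(X_1),\dots,C_a(X_s),Z^{q^{\deg a}})$, and for $P\in K[X_1,\dots,X_s]$ put $$l(P,Z)=\sum_{a\in A_+}\frac{a*(PZ)}{a},\qquad \mathfrak L(P,Z)=\exp_C(l(P,Z)),\qquad \mathbb S_s=\mathfrak L(X_1\cdots X_s,Z).$$ Finally let $K[t_1,\dots,t_s]$ act $K$-linearly on $K[X_1,\dots,X_s]$, with $t_j$ acting by the substitution $X_j\mapsto C_\theta(X_j)$, and put $\left(\sum_k f_kz^k\right).\left(\sum_{n\ge 1}G_nZ^n\right)=\sum_{k,n}(f_k.G_n)Z^{nq^k}$ for $f_k\in K[t_1,\dots,t_s]$ and $G_n\in K[X_1,\dots,X_s]$. **Proposition (Anderson–Stark units).** 1. $L(1,s,z)=\log_z(\sigma_s(t,z))$.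 2. $L(1,s,z).(X_1\cdots X_sZ)=l(X_1\cdots X_s,Z)=\log_C(\mathbb S_s)$. 3. $\sigma_s(t,z).(X_1\cdots X_sZ)=\mathbb S_s$, where $\mathbb S_s\in A[X_1,\dots,X_s,Z]$, and $\sigma_s(t,z)\in A[t_1,\dots,t_s,z]$. -/

import Mathlib

/-! Throughout, `F` is a finite field with `q` elements, `A = F[θ]` is `Polynomial F` (its variable
is `θ`), and `K = F(θ)` is `RatFunc F`. The ring `K[t₁, …, t_s]` and the ring `K[X₁, …, X_s]` are
both `MvPolynomial (Fin s) (RatFunc F)`; the variable of `PowerSeries` over it is `z`,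
respectively `Z`. -/

noncomputable section

namespace AndersonStark

open Polynomial

variable (F : Type*) [Field F] [Fintype F]

/-- The indeterminate `θ` as an element of `K`. -/
def theta : RatFunc F := algebraMap F[X] (RatFunc F) X

/-- `D₀ = 1`, `Dᵢ = (θ^(q^i) - θ) Dᵢ₋₁^q`. -/
def carlitzD : ℕ → RatFunc F
  | 0 => 1
  | i + 1 => (theta F ^ Fintype.card F ^ (i + 1) - theta F) * carlitzD i ^ Fintype.card F

/-- `l₀ = 1`, `lᵢ = (θ - θ^(q^i)) lᵢ₋₁`. -/
def carlitzL : ℕ → RatFunc F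
  | 0 => 1
  | i + 1 => (theta F - theta F ^ Fintype.card F ^ (i + 1)) * carlitzL i

/-- The set of monic polynomials of degree `d` in `A` is finite. -/
theorem finite_monic_natDegree (d : ℕ) : {a : F[X] | a.Monic ∧ a.natDegree = d}.Finite := by
  have : Finite (Polynomial.degreeLT F (d + 1)) :=
    Finite.of_equiv _ (Polynomial.degreeLTEquiv F (d + 1)).toEquiv.symm
  refine Set.Finite.subset (Set.toFinite (Polynomial.degreeLT F (d + 1) : Set F[X])) ?_
  rintro a ⟨-, ha⟩
  rw [SetLike.mem_coe, Polynomial.mem_degreeLT]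
  refine lt_of_le_of_lt Polynomial.degree_le_natDegree ?_
  rw [ha]
  exact_mod_cast Nat.lt_succ_self d

/-- `A_{+,d}`: the monic polynomials of degree `d` in `A`. -/
def monicOfDegree (d : ℕ) : Finset F[X] := (finite_monic_natDegree F d).toFinset

/-- The sum, coefficient by coefficient, of a family of formal power series. It is used for
families such that every coefficient vanishes for all but finitely many members of the family. -/
def formalSum {ι R : Type*} [CommRing R] (u : ι → PowerSeries R) : PowerSeries R :=
  PowerSeries.mk fun n => ∑ᶠ i, PowerSeries.coeff n (u i)

variable {F}

/-! ### The side of the variables `t₁, …, t_s, z` -/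

/-- `φ` on `K[t₁, …, t_s]`: it raises the coefficients to the power `q` and fixes the `tⱼ`. -/
def coeffFrob (s : ℕ) : MvPolynomial (Fin s) (RatFunc F) →+* MvPolynomial (Fin s) (RatFunc F) :=
  MvPolynomial.map (FiniteField.frobeniusAlgHom F (RatFunc F)).toRingHom

/-- `τ_z = z (t₁ - θ) ⋯ (t_s - θ) φ` on `K[t₁, …, t_s][[z]]`. -/
def tauZ {s : ℕ} (f : PowerSeries (MvPolynomial (Fin s) (RatFunc F))) :
    PowerSeries (MvPolynomial (Fin s) (RatFunc F)) :=
  PowerSeries.X *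
    PowerSeries.C (∏ j : Fin s, (MvPolynomial.X j - MvPolynomial.C (theta F))) *
    PowerSeries.map (coeffFrob s) f

/-- `exp_z = ∑ⱼ (1 / Dⱼ) τ_zʲ` on `K[t₁, …, t_s][[z]]`. -/
def expZ {s : ℕ} (f : PowerSeries (MvPolynomial (Fin s) (RatFunc F))) :
    PowerSeries (MvPolynomial (Fin s) (RatFunc F)) :=
  formalSum fun j : ℕ => (carlitzD F j)⁻¹ • tauZ^[j] f

/-- `log_z = ∑ⱼ (1 / lⱼ) τ_zʲ` on `K[t₁, …, t_s][[z]]`. -/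
def logZ {s : ℕ} (f : PowerSeries (MvPolynomial (Fin s) (RatFunc F))) :
    PowerSeries (MvPolynomial (Fin s) (RatFunc F)) :=
  formalSum fun j : ℕ => (carlitzL F j)⁻¹ • tauZ^[j] f

variable (F) in
/-- `L(N, s, z) = ∑_d z^d ∑_{a ∈ A_{+,d}} a(t₁) ⋯ a(t_s) / a^N`. -/
def LSeriesZ (N : ℤ) (s : ℕ) : PowerSeries (MvPolynomial (Fin s) (RatFunc F)) :=
  PowerSeries.mk fun d => ∑ a ∈ monicOfDegree F d,
    (algebraMap F[X] (RatFunc F) a ^ N)⁻¹ •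
      ∏ j : Fin s, Polynomial.aeval (MvPolynomial.X j : MvPolynomial (Fin s) (RatFunc F)) a

variable (F) in
/-- The Anderson–Stark unit `σ_s(t, z) = exp_z(L(1, s, z))`. -/
def sigma (s : ℕ) : PowerSeries (MvPolynomial (Fin s) (RatFunc F)) := expZ (LSeriesZ F 1 s)

/-! ### The side of the variables `X₁, …, X_s, Z` -/

/-- `exp_C = ∑ⱼ (1 / Dⱼ) τʲ` on power series in `Z` without constant term, where `τ(G) = G^q`. -/
def expC {s : ℕ} (G : PowerSeries (MvPolynomial (Fin s) (RatFunc F))) :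
    PowerSeries (MvPolynomial (Fin s) (RatFunc F)) :=
  formalSum fun j : ℕ => (carlitzD F j)⁻¹ • G ^ Fintype.card F ^ j

/-- `log_C = ∑ⱼ (1 / lⱼ) τʲ` on power series in `Z` without constant term, where `τ(G) = G^q`. -/
def logC {s : ℕ} (G : PowerSeries (MvPolynomial (Fin s) (RatFunc F))) :
    PowerSeries (MvPolynomial (Fin s) (RatFunc F)) :=
  formalSum fun j : ℕ => (carlitzL F j)⁻¹ • G ^ Fintype.card F ^ j

/-- The Carlitz module `C`: the morphism of `F`-algebras from `A` to the `F`-linear endomorphisms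
of an `A`-algebra `R` such that `C_θ = θ + τ`, where `τ` is the Frobenius `m ↦ m^q` of `R`. -/
def carlitz (R : Type*) [CommRing R] [Algebra F R] [Algebra F[X] R] : F[X] →ₐ[F] Module.End F R :=
  Polynomial.aeval (LinearMap.mulLeft F (algebraMap F[X] R X) +
    (FiniteField.frobeniusAlgHom F R).toLinearMap)

/-- `C_a(Xⱼ)` in `K[X₁, …, X_s]`. -/
def carlitzVar {s : ℕ} (a : F[X]) (j : Fin s) : MvPolynomial (Fin s) (RatFunc F) :=
  carlitz (MvPolynomial (Fin s) (RatFunc F)) a (MvPolynomial.X j)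

/-- `a * G = G(C_a(X₁), …, C_a(X_s), Z^(q^(deg a)))` for `G` in `K[X₁, …, X_s][[Z]]`. -/
def star {s : ℕ} (a : F[X]) (G : PowerSeries (MvPolynomial (Fin s) (RatFunc F))) :
    PowerSeries (MvPolynomial (Fin s) (RatFunc F)) :=
  PowerSeries.expand (Fintype.card F ^ a.natDegree) (pow_ne_zero _ Fintype.card_ne_zero)
    (PowerSeries.map (MvPolynomial.aeval (carlitzVar a)).toRingHom G)

/-- `l(P, Z) = ∑_{a ∈ A_+} (a * (P Z)) / a`. -/
def lSeries {s : ℕ} (P : MvPolynomial (Fin s) (RatFunc F)) :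
    PowerSeries (MvPolynomial (Fin s) (RatFunc F)) :=
  formalSum fun a : {a : F[X] // a.Monic} =>
    (algebraMap F[X] (RatFunc F) a)⁻¹ • star a.1 (PowerSeries.C P * PowerSeries.X)

/-- `𝔏(P, Z) = exp_C(l(P, Z))`. -/
def frakL {s : ℕ} (P : MvPolynomial (Fin s) (RatFunc F)) :
    PowerSeries (MvPolynomial (Fin s) (RatFunc F)) :=
  expC (lSeries P)

variable (F) in
/-- The special polynomial `𝕊_s = 𝔏(X₁ ⋯ X_s, Z)`. -/
def specialS (s : ℕ) : PowerSeries (MvPolynomial (Fin s) (RatFunc F)) :=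
  frakL (∏ j : Fin s, MvPolynomial.X j)

/-! ### The dictionary -/

/-- The action of `K[t₁, …, t_s]` on `K[X₁, …, X_s]`: it is `K`-linear in `f`, and
`t₁^i₁ ⋯ t_s^i_s` sends `P` to `P(C_{θ^i₁}(X₁), …, C_{θ^i_s}(X_s))`, so that `tⱼ` acts by the
substitution of `C_θ(Xⱼ)` for `Xⱼ`. -/
def act {s : ℕ} (f P : MvPolynomial (Fin s) (RatFunc F)) : MvPolynomial (Fin s) (RatFunc F) :=
  ∑ i ∈ f.support,
    MvPolynomial.coeff i f • MvPolynomial.aeval (fun j => carlitzVar (X ^ i j) j) P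

/-- The action of `K[t₁, …, t_s][[z]]` on power series in `Z` without constant term:
`(∑_k f_k z^k) . (∑_n G_n Z^n) = ∑_{k, n} (f_k . G_n) Z^(n q^k)`. -/
def actZ {s : ℕ} (f G : PowerSeries (MvPolynomial (Fin s) (RatFunc F))) :
    PowerSeries (MvPolynomial (Fin s) (RatFunc F)) :=
  formalSum fun kn : ℕ × ℕ =>
    PowerSeries.monomial (kn.2 * Fintype.card F ^ kn.1)
      (act (PowerSeries.coeff kn.1 f) (PowerSeries.coeff kn.2 G))

variable (F) in
/-- The monomial `X₁ ⋯ X_s Z`. -/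
def monomialXZ (s : ℕ) : PowerSeries (MvPolynomial (Fin s) (RatFunc F)) :=
  PowerSeries.C (∏ j : Fin s, MvPolynomial.X j) * PowerSeries.X

/-- `f` lies in the subring `A[t₁, …, t_s, z]` of `K[t₁, …, t_s][[z]]` (or, in the other
variables, in the subring `A[X₁, …, X_s, Z]` of `K[X₁, …, X_s][[Z]]`). -/
def IsIntegralPolynomial {s : ℕ} (f : PowerSeries (MvPolynomial (Fin s) (RatFunc F))) : Prop :=
  ∃ p : Polynomial (MvPolynomial (Fin s) F[X]),
    f = (p.map (MvPolynomial.map (algebraMap F[X] (RatFunc F))) :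
      Polynomial (MvPolynomial (Fin s) (RatFunc F)))

/-! ### The families that are summed are locally finite -/

theorem coeff_iterate_tauZ {s : ℕ} (f : PowerSeries (MvPolynomial (Fin s) (RatFunc F)))
    {j n : ℕ} (h : n < j) : PowerSeries.coeff n (tauZ^[j] f) = 0 := by
  induction j generalizing n with
  | zero => omega
  | succ j ih =>
    rw [Function.iterate_succ_apply', tauZ, mul_assoc]
    cases n with
    | zero => simp
    | succ n =>
      rw [PowerSeries.coeff_succ_X_mul, PowerSeries.coeff_C_mul, PowerSeries.coeff_map,
        ih (by omega), map_zero, mul_zero]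

theorem coeff_pow_card_pow {s : ℕ} {G : PowerSeries (MvPolynomial (Fin s) (RatFunc F))}
    (hG : PowerSeries.constantCoeff G = 0) {j n : ℕ} (h : n < j) :
    PowerSeries.coeff n (G ^ Fintype.card F ^ j) = 0 := by
  apply PowerSeries.coeff_of_lt_order
  have h1 : (1 : ℕ∞) ≤ G.order := by
    rw [Order.one_le_iff_ne_zero]
    simpa [PowerSeries.order_ne_zero_iff_constCoeff_eq_zero] using hG
  have h2 : j < Fintype.card F ^ j := Nat.lt_pow_self Fintype.one_lt_card
  calc (n : ℕ∞) < ((Fintype.card F ^ j : ℕ) : ℕ∞) := by exact_mod_cast h.trans h2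
    _ = (Fintype.card F ^ j) • (1 : ℕ∞) := by simp
    _ ≤ (Fintype.card F ^ j) • G.order := nsmul_le_nsmul_right h1 _
    _ ≤ _ := PowerSeries.le_order_pow _ _

theorem star_C_mul_X {s : ℕ} (a : F[X]) (P : MvPolynomial (Fin s) (RatFunc F)) :
    star a (PowerSeries.C P * PowerSeries.X) =
      PowerSeries.C (MvPolynomial.aeval (carlitzVar a) P) *
        PowerSeries.X ^ Fintype.card F ^ a.natDegree := by
  simp only [star, map_mul, PowerSeries.map_C, PowerSeries.map_X, PowerSeries.expand_X]
  rw [PowerSeries.expand_C]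
  rfl

theorem constantCoeff_lSeries {s : ℕ} (P : MvPolynomial (Fin s) (RatFunc F)) :
    PowerSeries.constantCoeff (lSeries P) = 0 := by
  rw [← PowerSeries.coeff_zero_eq_constantCoeff_apply, lSeries, formalSum, PowerSeries.coeff_mk]
  refine finsum_eq_zero_of_forall_eq_zero fun a => ?_
  have h : 0 ≠ Fintype.card F ^ a.1.natDegree := (pow_ne_zero _ Fintype.card_ne_zero).symm
  simp [star_C_mul_X, PowerSeries.coeff_X_pow, h]

theorem finite_support_lSeries {s : ℕ} (P : MvPolynomial (Fin s) (RatFunc F)) (n : ℕ) :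
    (Function.support fun a : {a : F[X] // a.Monic} => PowerSeries.coeff n
      ((algebraMap F[X] (RatFunc F) a)⁻¹ • star a.1 (PowerSeries.C P * PowerSeries.X))).Finite := by
  have hfin : (⋃ d ∈ Finset.range (n + 1), {a : F[X] | a.Monic ∧ a.natDegree = d}).Finite :=
    Set.Finite.biUnion (Finset.finite_toSet _) fun d _ => finite_monic_natDegree F d
  refine Set.Finite.subset (hfin.preimage Subtype.val_injective.injOn) fun a ha => ?_
  simp only [Set.mem_preimage, Set.mem_iUnion]
  refine ⟨a.1.natDegree, ?_, a.2, rfl⟩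
  by_contra hd
  have h2 : a.1.natDegree < Fintype.card F ^ a.1.natDegree := Nat.lt_pow_self Fintype.one_lt_card
  have h3 : n ≠ Fintype.card F ^ a.1.natDegree := by
    simp only [Finset.mem_range] at hd
    omega
  exact ha (by simp [star_C_mul_X, PowerSeries.coeff_X_pow, h3])

theorem finite_support_actZ {s : ℕ} {f G : PowerSeries (MvPolynomial (Fin s) (RatFunc F))}
    (hG : PowerSeries.constantCoeff G = 0) (m : ℕ) :
    (Function.support fun kn : ℕ × ℕ => PowerSeries.coeff m
      (PowerSeries.monomial (kn.2 * Fintype.card F ^ kn.1)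
        (act (PowerSeries.coeff kn.1 f) (PowerSeries.coeff kn.2 G)))).Finite := by
  refine Set.Finite.subset
    (Finset.finite_toSet (Finset.range (m + 1) ×ˢ Finset.range (m + 1))) ?_
  rintro ⟨k, n⟩ h
  have hm : m = n * Fintype.card F ^ k := by
    by_contra hne
    exact h (by simp [PowerSeries.coeff_monomial, hne])
  have hn : n ≠ 0 := by
    rintro rfl
    exact h (by simp [act, hG])
  have h2 : k < Fintype.card F ^ k := Nat.lt_pow_self Fintype.one_lt_card
  have h3 : Fintype.card F ^ k ≤ n * Fintype.card F ^ k :=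
    Nat.le_mul_of_pos_left _ (Nat.pos_of_ne_zero hn)
  have h4 : n ≤ n * Fintype.card F ^ k := Nat.le_mul_of_pos_right _ (by omega)
  simp only [Finset.coe_product, Set.mem_prod, Finset.mem_coe, Finset.mem_range]
  omega

end AndersonStark

end

noncomputable section

namespace AndersonStark

open Polynomial
open Finset.HasAntidiagonal (antidiagonal mem_antidiagonal)

variable {F : Type*} [Field F]

/-! ### Polynomials with coefficients in a subring -/

/-! The formal part rests on two facts. The operators `∑ⱼ αⱼ τ_zʲ` compose like twisted power series
with `τ c = c^q τ`, and the Carlitz logarithm is a left inverse of the exponential in that ring;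
hence `logZ_expZ`. The action on `X₁ ⋯ X_s Z` turns `τ_z` into `G ↦ G^q`, because `C_{θ^(i+1)} - θ
C_{θ^i}` is the `q`-th power of `C_{θ^i}` (`actLinear_tau`). So `exp_z` and `log_z` become `exp_C`
and `log_C`, while `a(t₁) ⋯ a(t_s)` becomes `C_a(X₁) ⋯ C_a(X_s)`.

Integrality of `σ_s` is proved one monic irreducible `P` at a time; let `d` be its degree and `A_P`
the localization. Up to `P`-multiples of `A_P`-integral terms, `P L` equals `z^d P(t₁) ⋯ P(t_s) L`,
the contribution of the `a` divisible by `P`. As `P` occurs in `D_j` to a power less than `q^j`,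
`exp_z` preserves this congruence, and it becomes `C_P(τ_z) σ ≡ z^d P(t₁) ⋯ P(t_s) σ`. On
coefficients already known to be integral, `C_P(τ_z) ≡ τ_z^d ≡ z^d P(t₁) ⋯ P(t_s)` modulo `P`, since
`C_P ≡ τ^d`, `φ^d ≡ 1` and `∏_{k<d} (t - θ^(q^k)) ≡ P(t)`. Induction on the exponent of `z`
therefore isolates `P σ_n ≡ 0`, that is, `σ_n` is integral at `P`
(`coeff_sigma_mem_localPolynomials`).

Finally `σ_s` is a polynomial in `z`: for `n ≥ s` its `n`-th coefficient has negative degree in `θ`,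
and an element of `A` of negative degree is zero (`coeff_sigma_eq_zero`). The action on `X₁ ⋯ X_s Z`
carries both properties over to `𝕊_s`. -/

theorem mem_range_map_iff {R S : Type*} [CommRing R] [CommRing S] (g : R →+* S) {σ : Type*}
    {f : MvPolynomial σ S} :
    f ∈ (MvPolynomial.map (σ := σ) g).range ↔ ∀ m, MvPolynomial.coeff m f ∈ g.range := by
  constructor
  · rintro ⟨p, rfl⟩ m
    exact ⟨p.coeff m, (MvPolynomial.coeff_map _ _ _).symm⟩
  · intro h
    refine (MvPolynomial.mem_range_map_iff_coeffs_subset (f := g)).2 fun c hc => ?_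
    obtain ⟨m, -, rfl⟩ := MvPolynomial.mem_coeffs_iff.1 hc
    exact h m

theorem isIntegralPolynomial_of_coeff {s : ℕ}
    {f : PowerSeries (MvPolynomial (Fin s) (RatFunc F))} (N : ℕ)
    (hf : ∀ n, PowerSeries.coeff n f ∈
      (MvPolynomial.map (σ := Fin s) (algebraMap F[X] (RatFunc F))).range)
    (hN : ∀ n, N ≤ n → PowerSeries.coeff n f = 0) : IsIntegralPolynomial f := by
  choose g hg using hf
  refine ⟨∑ i ∈ Finset.range N, monomial i (g i), ?_⟩
  ext1 n
  rw [Polynomial.coeff_coe, Polynomial.coeff_map, Polynomial.finsetSum_coeff]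
  simp only [coeff_monomial, Finset.sum_ite_eq', Finset.mem_range]
  split_ifs with h
  · exact (hg n).symm
  · rw [map_zero, hN n (not_lt.1 h)]

/-! ### The localization of `A` at an irreducible polynomial -/

/-- The localization of `A` at the prime `P`, as a subring of `K`. -/
def localSubring {P : F[X]} (hP : Irreducible P) : Subring (RatFunc F) where
  carrier := {x | ∃ a b : F[X], ¬ P ∣ b ∧ x * algebraMap F[X] (RatFunc F) b = algebraMap _ _ a}
  zero_mem' := ⟨0, 1, fun h => hP.not_isUnit (isUnit_of_dvd_one h), by simp⟩
  one_mem' := ⟨1, 1, fun h => hP.not_isUnit (isUnit_of_dvd_one h), by simp⟩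
  mul_mem' := by
    rintro x y ⟨a, b, hb, h⟩ ⟨a', b', hb', h'⟩
    refine ⟨a * a', b * b', fun hd => (hP.prime.dvd_or_dvd hd).elim hb hb', ?_⟩
    rw [map_mul, map_mul, ← h, ← h']
    ring
  add_mem' := by
    rintro x y ⟨a, b, hb, h⟩ ⟨a', b', hb', h'⟩
    refine ⟨a * b' + a' * b, b * b', fun hd => (hP.prime.dvd_or_dvd hd).elim hb hb', ?_⟩
    rw [map_add, map_mul, map_mul, map_mul, ← h, ← h']
    ring
  neg_mem' := by
    rintro x ⟨a, b, hb, h⟩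
    exact ⟨-a, b, hb, by rw [map_neg, ← h, neg_mul]⟩

theorem algebraMap_mem_localSubring {P : F[X]} (hP : Irreducible P) (a : F[X]) :
    algebraMap F[X] (RatFunc F) a ∈ localSubring hP :=
  ⟨a, 1, fun h => hP.not_isUnit (isUnit_of_dvd_one h), by simp⟩

theorem inv_mem_localSubring {P : F[X]} (hP : Irreducible P) {b : F[X]} (hb : ¬ P ∣ b) :
    (algebraMap F[X] (RatFunc F) b)⁻¹ ∈ localSubring hP := by
  refine ⟨1, b, hb, ?_⟩
  rw [map_one, inv_mul_cancel₀]
  rw [map_ne_zero_iff _ (RatFunc.algebraMap_injective F)]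
  rintro rfl
  exact hb (dvd_zero _)

/-- A monic irreducible factor `P` of the reduced denominator would, by integrality at `P`, also
divide the numerator, against coprimality. Only monic `P` are needed, which suits the later use of
`C_P ≡ τ^d`. -/
theorem mem_range_of_forall_mem_localSubring {x : RatFunc F}
    (hx : ∀ (P : F[X]) (hP : Irreducible P), P.Monic → x ∈ localSubring hP) :
    x ∈ (algebraMap F[X] (RatFunc F)).range := by
  by_cases hu : IsUnit x.denom
  · have h1 : x.denom = 1 := x.monic_denom.eq_one_of_isUnit hu
    refine ⟨x.num, ?_⟩
    have := x.num_div_denom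
    rwa [h1, map_one, div_one] at this
  · obtain ⟨P, hm, hP, hd⟩ := exists_monic_irreducible_factor _ hu
    obtain ⟨a, b, hb, h⟩ := hx P hP hm
    have hden : algebraMap F[X] (RatFunc F) x.denom ≠ 0 := by
      rw [map_ne_zero_iff _ (RatFunc.algebraMap_injective F)]
      exact x.denom_ne_zero
    have h2 : x.num * b = a * x.denom := by
      apply RatFunc.algebraMap_injective F
      have := x.num_div_denom
      rw [div_eq_iff hden] at this
      rw [map_mul, map_mul, this, ← h]
      ring
    have h3 : P ∣ x.num * b := h2 ▸ Dvd.dvd.mul_left hd a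
    have h4 := (hP.prime.dvd_or_dvd h3).resolve_right hb
    exact absurd (x.isCoprime_num_denom.isUnit_of_dvd' h4 hd) hP.not_isUnit

/-- The polynomials over the localization of `A` at the prime `P`. -/
def localPolynomials {P : F[X]} (hP : Irreducible P) (s : ℕ) :
    Subring (MvPolynomial (Fin s) (RatFunc F)) :=
  (MvPolynomial.map (localSubring hP).subtype).range

theorem mem_localPolynomials {P : F[X]} (hP : Irreducible P) {s : ℕ}
    {f : MvPolynomial (Fin s) (RatFunc F)} :
    f ∈ localPolynomials hP s ↔ ∀ m, MvPolynomial.coeff m f ∈ localSubring hP := by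
  rw [localPolynomials, mem_range_map_iff, Subring.range_subtype]

theorem C_mem_localPolynomials {P : F[X]} (hP : Irreducible P) {s : ℕ} {c : RatFunc F}
    (hc : c ∈ localSubring hP) : MvPolynomial.C c ∈ localPolynomials hP s :=
  ⟨MvPolynomial.C ⟨c, hc⟩, by simp⟩

theorem X_mem_localPolynomials {P : F[X]} (hP : Irreducible P) {s : ℕ} (j : Fin s) :
    MvPolynomial.X j ∈ localPolynomials hP s :=
  ⟨MvPolynomial.X j, by simp⟩

theorem smul_mem_localPolynomials {P : F[X]} (hP : Irreducible P) {s : ℕ} {c : RatFunc F}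
    (hc : c ∈ localSubring hP) {f : MvPolynomial (Fin s) (RatFunc F)}
    (hf : f ∈ localPolynomials hP s) : c • f ∈ localPolynomials hP s := by
  rw [MvPolynomial.smul_eq_C_mul]
  exact mul_mem (C_mem_localPolynomials hP hc) hf

/-- The multiples of `P` among the polynomials over the localization of `A` at `P`. -/
def localMultiples {P : F[X]} (hP : Irreducible P) (s : ℕ) :
    AddSubgroup (MvPolynomial (Fin s) (RatFunc F)) :=
  (localPolynomials hP s).toAddSubgroup.map
    (DistribSMul.toAddMonoidHom _ (algebraMap F[X] (RatFunc F) P))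

theorem mem_localMultiples {P : F[X]} (hP : Irreducible P) {s : ℕ}
    {f : MvPolynomial (Fin s) (RatFunc F)} : f ∈ localMultiples hP s ↔
      ∃ g ∈ localPolynomials hP s, algebraMap F[X] (RatFunc F) P • g = f := Iff.rfl

theorem smul_mem_localMultiples_iff {P : F[X]} (hP : Irreducible P) {s : ℕ}
    {f : MvPolynomial (Fin s) (RatFunc F)} :
    algebraMap F[X] (RatFunc F) P • f ∈ localMultiples hP s ↔ f ∈ localPolynomials hP s := by
  have hP0 : algebraMap F[X] (RatFunc F) P ≠ 0 :=
    RatFunc.algebraMap_ne_zero hP.ne_zero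
  refine ⟨?_, fun h => ⟨f, h, rfl⟩⟩
  rintro ⟨g, hg, h⟩
  rwa [← smul_right_injective _ hP0 h]

theorem mul_mem_localMultiples {P : F[X]} (hP : Irreducible P) {s : ℕ}
    {f g : MvPolynomial (Fin s) (RatFunc F)} (hf : f ∈ localPolynomials hP s)
    (hg : g ∈ localMultiples hP s) : f * g ∈ localMultiples hP s := by
  obtain ⟨g, hg, rfl⟩ := hg
  exact ⟨f * g, (localPolynomials hP s).mul_mem hf hg, (mul_smul_comm _ _ _).symm⟩

theorem mem_localMultiples_of_coeff {P : F[X]} (hP : Irreducible P) {s : ℕ}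
    {f : MvPolynomial (Fin s) (RatFunc F)} (h : ∀ m, ∃ y ∈ localSubring hP,
      MvPolynomial.coeff m f = algebraMap F[X] (RatFunc F) P * y) : f ∈ localMultiples hP s := by
  have hP0 : algebraMap F[X] (RatFunc F) P ≠ 0 :=
    RatFunc.algebraMap_ne_zero hP.ne_zero
  rw [← smul_inv_smul₀ hP0 f, smul_mem_localMultiples_iff, mem_localPolynomials]
  intro m
  obtain ⟨y, hy, h⟩ := h m
  rwa [MvPolynomial.coeff_smul, h, smul_eq_mul, inv_mul_cancel_left₀ hP0]

theorem aeval_X_mem_localPolynomials {P : F[X]} (hP : Irreducible P) {s : ℕ} (j : Fin s)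
    (a : F[X]) : Polynomial.aeval (MvPolynomial.X j : MvPolynomial (Fin s) (RatFunc F)) a ∈
      localPolynomials hP s := by
  rw [Polynomial.aeval_eq_sum_range]
  refine sum_mem fun i _ => ?_
  rw [Algebra.smul_def, IsScalarTower.algebraMap_apply F (RatFunc F) (MvPolynomial _ _),
    IsScalarTower.algebraMap_apply F F[X] (RatFunc F)]
  exact mul_mem (C_mem_localPolynomials hP (algebraMap_mem_localSubring hP _))
    (pow_mem (X_mem_localPolynomials hP j) _)

/-- Congruences modulo `P` between integral elements multiply: `f F - g G = f (F - G) + G (f - g)`.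
-/
theorem prod_sub_prod_mem_localMultiples {P : F[X]} (hP : Irreducible P) {s : ℕ} {ι : Type*}
    (u : Finset ι) {f g : ι → MvPolynomial (Fin s) (RatFunc F)}
    (hf : ∀ i ∈ u, f i ∈ localPolynomials hP s) (hg : ∀ i ∈ u, g i ∈ localPolynomials hP s)
    (h : ∀ i ∈ u, f i - g i ∈ localMultiples hP s) :
    ∏ i ∈ u, f i - ∏ i ∈ u, g i ∈ localMultiples hP s := by
  classical
  induction u using Finset.induction_on with
  | empty => simp [zero_mem]
  | insert i u hi ih =>
    rw [Finset.prod_insert hi, Finset.prod_insert hi]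
    have h1 := ih (fun k hk => hf k (Finset.mem_insert_of_mem hk))
      (fun k hk => hg k (Finset.mem_insert_of_mem hk))
      (fun k hk => h k (Finset.mem_insert_of_mem hk))
    have h2 := mul_mem_localMultiples hP (hf i (Finset.mem_insert_self i u)) h1
    have h3 := mul_mem_localMultiples hP
      (prod_mem fun k hk => hg k (Finset.mem_insert_of_mem hk)) (h i (Finset.mem_insert_self i u))
    convert add_mem h2 h3 using 1
    ring

/-! ### Bounds for the degree in `θ` -/

open scoped Classical in
variable (F) in
/-- The polynomials over `K` all of whose coefficients have degree at most `n` in `θ`. -/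
def degreeAtMost (s : ℕ) (n : ℤ) : AddSubgroup (MvPolynomial (Fin s) (RatFunc F)) where
  carrier := {f | ∀ m, RatFunc.inftyValuation F (MvPolynomial.coeff m f) ≤ WithZero.exp n}
  zero_mem' := by simp
  add_mem' := fun {f g} hf hg m => by
    rw [MvPolynomial.coeff_add]
    exact (RatFunc.inftyValuation F).map_add_le (hf m) (hg m)
  neg_mem' := fun {f} hf m => by
    rw [MvPolynomial.coeff_neg, Valuation.map_neg]
    exact hf m

theorem degreeAtMost_mono {s : ℕ} {n n' : ℤ} (h : n ≤ n') :
    degreeAtMost F s n ≤ degreeAtMost F s n' := fun _ hf m =>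
  (hf m).trans (WithZero.exp_le_exp.2 h)

theorem mul_mem_degreeAtMost {s : ℕ} {n n' : ℤ} {f g : MvPolynomial (Fin s) (RatFunc F)}
    (hf : f ∈ degreeAtMost F s n) (hg : g ∈ degreeAtMost F s n') :
    f * g ∈ degreeAtMost F s (n + n') := by
  classical
  intro m
  rw [MvPolynomial.coeff_mul]
  refine (RatFunc.inftyValuation F).map_sum_le fun p _ => ?_
  rw [map_mul, WithZero.exp_add]
  exact mul_le_mul' (hf _) (hg _)

open scoped Classical in
theorem C_mem_degreeAtMost {s : ℕ} {n : ℤ} {c : RatFunc F}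
    (hc : RatFunc.inftyValuation F c ≤ WithZero.exp n) :
    MvPolynomial.C c ∈ degreeAtMost F s n := by
  intro m
  rw [MvPolynomial.coeff_C]
  split_ifs
  · exact hc
  · simp

theorem X_mem_degreeAtMost {s : ℕ} (j : Fin s) :
    (MvPolynomial.X j : MvPolynomial (Fin s) (RatFunc F)) ∈ degreeAtMost F s 0 := by
  classical
  intro m
  rw [MvPolynomial.coeff_X]
  split_ifs <;> simp

theorem prod_mem_degreeAtMost {s : ℕ} {ι : Type*} (u : Finset ι) {n : ι → ℤ}
    {f : ι → MvPolynomial (Fin s) (RatFunc F)} (hf : ∀ i ∈ u, f i ∈ degreeAtMost F s (n i)) :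
    ∏ i ∈ u, f i ∈ degreeAtMost F s (∑ i ∈ u, n i) := by
  classical
  induction u using Finset.induction_on with
  | empty => exact C_mem_degreeAtMost (c := 1) (by simp)
  | insert i u hi ih =>
    rw [Finset.prod_insert hi, Finset.sum_insert hi]
    exact mul_mem_degreeAtMost (hf i (Finset.mem_insert_self i u))
      (ih fun k hk => hf k (Finset.mem_insert_of_mem hk))

open scoped Classical in
theorem inftyValuation_algebraMap {a : F[X]} (ha : a ≠ 0) :
    RatFunc.inftyValuation F (algebraMap F[X] (RatFunc F) a) =
      WithZero.exp (a.natDegree : ℤ) := by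
  rw [RatFunc.inftyValuation_apply, RatFunc.inftyValuation.polynomial F ha]

variable [Fintype F]

/-! ### Twisted power series acting on `K[t₁, …, t_s][[z]]` -/

theorem frobeniusAlgHom_pow_apply {R : Type*} [CommRing R] [Algebra F R] (n : ℕ) (x : R) :
    (FiniteField.frobeniusAlgHom F R ^ n) x = x ^ Fintype.card F ^ n := by
  rw [AlgHom.coe_pow, FiniteField.coe_frobeniusAlgHom, pow_iterate]

theorem sub_pow_card_pow {R : Type*} [CommRing R] [Algebra F R] (x y : R) (n : ℕ) :
    (x - y) ^ Fintype.card F ^ n = x ^ Fintype.card F ^ n - y ^ Fintype.card F ^ n := by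
  simp only [← frobeniusAlgHom_pow_apply, map_sub]

theorem add_pow_card_pow {R : Type*} [CommRing R] [Algebra F R] (x y : R) (n : ℕ) :
    (x + y) ^ Fintype.card F ^ n = x ^ Fintype.card F ^ n + y ^ Fintype.card F ^ n := by
  simp only [← frobeniusAlgHom_pow_apply, map_add]

theorem sum_pow_card_pow {R ι : Type*} [CommRing R] [Algebra F R] (u : Finset ι) (x : ι → R)
    (n : ℕ) : (∑ i ∈ u, x i) ^ Fintype.card F ^ n = ∑ i ∈ u, x i ^ Fintype.card F ^ n := by
  simp only [← frobeniusAlgHom_pow_apply, map_sum]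

theorem theta_pow_sub_theta_ne_zero {n : ℕ} (hn : n ≠ 0) :
    theta F ^ Fintype.card F ^ n - theta F ≠ 0 := by
  have h : theta F ^ Fintype.card F ^ n - theta F =
      algebraMap F[X] (RatFunc F) (X ^ Fintype.card F ^ n - X) := by
    simp [theta]
  rw [h, map_ne_zero_iff _ (RatFunc.algebraMap_injective F)]
  exact FiniteField.X_pow_card_pow_sub_X_ne_zero F hn Fintype.one_lt_card

theorem carlitzD_ne_zero (n : ℕ) : carlitzD F n ≠ 0 := by
  induction n with
  | zero => exact one_ne_zero
  | succ n ih =>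
    exact mul_ne_zero (theta_pow_sub_theta_ne_zero n.succ_ne_zero) (pow_ne_zero _ ih)

theorem carlitzL_ne_zero (n : ℕ) : carlitzL F n ≠ 0 := by
  induction n with
  | zero => exact one_ne_zero
  | succ n ih =>
    refine mul_ne_zero ?_ ih
    rw [← neg_sub]
    exact neg_ne_zero.2 (theta_pow_sub_theta_ne_zero n.succ_ne_zero)

theorem coeffFrob_C {s : ℕ} (c : RatFunc F) :
    coeffFrob s (MvPolynomial.C c) = MvPolynomial.C (c ^ Fintype.card F) := by
  simp [coeffFrob]

theorem coeffFrob_X {s : ℕ} (j : Fin s) :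
    coeffFrob (F := F) s (MvPolynomial.X j) = MvPolynomial.X j := by
  simp [coeffFrob]

theorem coeffFrob_iterate_smul {s : ℕ} (i : ℕ) (c : RatFunc F)
    (f : MvPolynomial (Fin s) (RatFunc F)) :
    (coeffFrob s)^[i] (c • f) = c ^ Fintype.card F ^ i • (coeffFrob s)^[i] f := by
  induction i with
  | zero => simp
  | succ i ih =>
    rw [Function.iterate_succ_apply', ih, Function.iterate_succ_apply', MvPolynomial.smul_eq_C_mul,
      map_mul, coeffFrob_C, MvPolynomial.smul_eq_C_mul, ← pow_mul, ← pow_succ]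

variable (F) in
/-- The product `∏_{k < i} (t₁ - θ^(q^k)) ⋯ (t_s - θ^(q^k))`, so that
`τ_z^i (f z^n) = twist i * φ^i(f) z^(n + i)`. -/
def twist (s i : ℕ) : MvPolynomial (Fin s) (RatFunc F) :=
  ∏ k ∈ Finset.range i, ∏ j : Fin s,
    (MvPolynomial.X j - MvPolynomial.C (theta F ^ Fintype.card F ^ k))

/-- The cocycle relation behind `τ_z^i τ_z^k = τ_z^(i+k)`: `φ^i` replaces `θ^(q^m)` by
`θ^(q^(i+m))`, so the two products run over consecutive ranges of exponents. -/
theorem coeffFrob_iterate_twist_mul (s i k : ℕ) :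
    twist F s i * (coeffFrob s)^[i] (twist F s k) = twist F s (i + k) := by
  have h : ∀ k, (coeffFrob s)^[i] (twist F s k) = ∏ m ∈ Finset.range k, ∏ j : Fin s,
      (MvPolynomial.X j - MvPolynomial.C (theta F ^ Fintype.card F ^ (i + m))) := by
    intro k
    induction i with
    | zero => simp [twist]
    | succ i ih =>
      rw [Function.iterate_succ_apply', ih]
      simp only [map_prod, map_sub, coeffFrob_X, coeffFrob_C, ← pow_mul, ← pow_succ]
      simp only [add_right_comm]
  rw [h, twist, twist, Finset.prod_range_add]

theorem coeff_tauZ_iterate {s : ℕ} (f : PowerSeries (MvPolynomial (Fin s) (RatFunc F)))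
    (i n : ℕ) : PowerSeries.coeff (i + n) (tauZ^[i] f) =
      twist F s i * (coeffFrob s)^[i] (PowerSeries.coeff n f) := by
  induction i with
  | zero => simp [twist]
  | succ i ih =>
    rw [Function.iterate_succ_apply', tauZ, mul_assoc, add_right_comm,
      PowerSeries.coeff_succ_X_mul, PowerSeries.coeff_C_mul, PowerSeries.coeff_map, ih, map_mul,
      ← mul_assoc, Function.iterate_succ_apply', add_comm i 1, ← coeffFrob_iterate_twist_mul]
    simp [twist]

/-- The operator `∑ⱼ αⱼ τ_zʲ` on `K[t₁, …, t_s][[z]]`. -/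
def twistedOp {s : ℕ} (α : ℕ → RatFunc F) (f : PowerSeries (MvPolynomial (Fin s) (RatFunc F))) :
    PowerSeries (MvPolynomial (Fin s) (RatFunc F)) :=
  formalSum fun j : ℕ => α j • tauZ^[j] f

/-- Since `τ_zʲ` raises the order in `z` by `j`, only `j ≤ n` contribute, and the formal sum becomes
a finite convolution. -/
theorem coeff_twistedOp {s : ℕ} (α : ℕ → RatFunc F)
    (f : PowerSeries (MvPolynomial (Fin s) (RatFunc F))) (n : ℕ) :
    PowerSeries.coeff n (twistedOp α f) = ∑ p ∈ antidiagonal n,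
      α p.1 • (twist F s p.1 * (coeffFrob s)^[p.1] (PowerSeries.coeff p.2 f)) := by
  rw [twistedOp, formalSum, PowerSeries.coeff_mk,
    finsum_eq_sum_of_support_subset (s := Finset.range (n + 1)),
    Finset.Nat.sum_antidiagonal_eq_sum_range_succ_mk]
  · refine Finset.sum_congr rfl fun i hi => ?_
    rw [PowerSeries.coeff_smul, ← coeff_tauZ_iterate,
      Nat.add_sub_cancel' (Nat.lt_succ_iff.1 (Finset.mem_range.1 hi))]
  · intro j hj
    by_contra h
    refine hj ?_
    change PowerSeries.coeff n _ = 0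
    rw [PowerSeries.coeff_smul, coeff_iterate_tauZ, smul_zero]
    simpa using h

/-- The product of twisted power series: moving a constant `c` to the left past `τ^i` turns it into
`c^(q^i)`. -/
theorem twistedOp_comp {s : ℕ} (α β : ℕ → RatFunc F)
    (f : PowerSeries (MvPolynomial (Fin s) (RatFunc F))) :
    twistedOp α (twistedOp β f) = twistedOp
      (fun n => ∑ p ∈ antidiagonal n, α p.1 * β p.2 ^ Fintype.card F ^ p.1) f := by
  ext1 n
  simp only [coeff_twistedOp, Finset.sum_smul, ← RingHom.coe_pow, map_sum, Finset.mul_sum,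
    Finset.smul_sum]
  simp only [RingHom.coe_pow, coeffFrob_iterate_smul, iterate_map_mul]
  rw [Finset.sum_sigma', Finset.sum_sigma']
  -- Both sides are sums over triples of exponents with total `n`, grouped as `i + (j + m)` and as
  -- `(i + j) + m`.
  refine Finset.sum_nbij' (fun x => ⟨(x.1.1 + x.2.1, x.2.2), (x.1.1, x.2.1)⟩)
    (fun x => ⟨(x.2.1, x.2.2 + x.1.2), (x.2.2, x.1.2)⟩) ?_ ?_ ?_ ?_ ?_
  · rintro ⟨⟨a, b⟩, ⟨c, d⟩⟩ h
    simp only [Finset.mem_sigma, mem_antidiagonal] at h ⊢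
    obtain ⟨rfl, rfl⟩ := h
    exact ⟨by omega, trivial⟩
  · rintro ⟨⟨a, b⟩, ⟨c, d⟩⟩ h
    simp only [Finset.mem_sigma, mem_antidiagonal] at h ⊢
    obtain ⟨rfl, rfl⟩ := h
    exact ⟨by omega, trivial⟩
  · rintro ⟨⟨a, b⟩, ⟨c, d⟩⟩ h
    simp only [Finset.mem_sigma, mem_antidiagonal] at h
    obtain ⟨-, rfl⟩ := h
    rfl
  · rintro ⟨⟨a, b⟩, ⟨c, d⟩⟩ h
    simp only [Finset.mem_sigma, mem_antidiagonal] at h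
    obtain ⟨-, rfl⟩ := h
    rfl
  · rintro ⟨⟨a, b⟩, ⟨c, d⟩⟩ -
    simp only [Function.iterate_add_apply, ← coeffFrob_iterate_twist_mul, mul_smul_comm, smul_smul,
      mul_assoc]

theorem expZ_eq_twistedOp {s : ℕ} (f : PowerSeries (MvPolynomial (Fin s) (RatFunc F))) :
    expZ f = twistedOp (fun j => (carlitzD F j)⁻¹) f := rfl

theorem logZ_eq_twistedOp {s : ℕ} (f : PowerSeries (MvPolynomial (Fin s) (RatFunc F))) :
    logZ f = twistedOp (fun j => (carlitzL F j)⁻¹) f := rfl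

theorem twistedOp_sub {s : ℕ} (α : ℕ → RatFunc F)
    (f g : PowerSeries (MvPolynomial (Fin s) (RatFunc F))) :
    twistedOp α (f - g) = twistedOp α f - twistedOp α g := by
  ext1 n
  simp only [coeff_twistedOp, map_sub, ← RingHom.coe_pow, mul_sub, smul_sub,
    Finset.sum_sub_distrib]

/-- Multiplication by a constant of `K` as a twisted operator. -/
theorem twistedOp_single {s : ℕ} (c : RatFunc F)
    (f : PowerSeries (MvPolynomial (Fin s) (RatFunc F))) :
    twistedOp (Pi.single 0 c) f = c • f := by
  ext1 n
  rw [coeff_twistedOp, Finset.sum_eq_single (0, n)]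
  · simp [twist]
  · rintro ⟨a, b⟩ h hne
    simp only [mem_antidiagonal] at h
    have : a ≠ 0 := by
      rintro rfl
      exact hne (by simpa using h)
    simp [this]
  · simp

/-! ### The logarithm as left inverse of the exponential -/

theorem inv_carlitzD_succ_mul (i : ℕ) :
    (carlitzD F (i + 1))⁻¹ * (theta F ^ Fintype.card F ^ (i + 1) - theta F) =
      (carlitzD F i)⁻¹ ^ Fintype.card F := by
  have h1 := carlitzD_ne_zero (F := F) (i + 1)
  have h2 := carlitzD_ne_zero (F := F) i
  rw [inv_mul_eq_div, div_eq_iff h1, carlitzD, inv_pow, mul_left_comm,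
    inv_mul_cancel₀ (pow_ne_zero _ h2), mul_one]

/-- This is the coefficient of `τ^n` in `log ∘ exp`. For positive degree `n`, multiply by `θ^(q^n) -
θ = (θ^(q^n) - θ^(q^i)) + (θ^(q^i) - θ)`. The recursion of `D` absorbs the first bracket, that of
`l` the second, and the two resulting sums in degree `n - 1` cancel. -/
theorem sum_inv_carlitzL_mul_inv_carlitzD (n : ℕ) :
    ∑ p ∈ antidiagonal n, (carlitzL F p.1)⁻¹ * (carlitzD F p.2)⁻¹ ^ Fintype.card F ^ p.1 =
      (Pi.single 0 1 : ℕ → RatFunc F) n := by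
  cases n with
  | zero => simp [carlitzL, carlitzD]
  | succ n =>
    rw [Pi.single_eq_of_ne n.succ_ne_zero]
    refine (mul_eq_zero.1 ?_).resolve_left (theta_pow_sub_theta_ne_zero (F := F) n.succ_ne_zero)
    have hq : 0 < Fintype.card F := Fintype.card_pos
    have hL : ∀ i, (carlitzL F (i + 1))⁻¹ * (theta F - theta F ^ Fintype.card F ^ (i + 1)) =
        (carlitzL F i)⁻¹ := by
      intro i
      have h1 := carlitzL_ne_zero (F := F) (i + 1)
      have h2 := carlitzL_ne_zero (F := F) i
      rw [inv_mul_eq_div, div_eq_iff h1, carlitzL]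
      field_simp
    have key : ∀ p ∈ antidiagonal (n + 1), (theta F ^ Fintype.card F ^ (n + 1) - theta F) *
        ((carlitzL F p.1)⁻¹ * (carlitzD F p.2)⁻¹ ^ Fintype.card F ^ p.1) =
        (carlitzL F p.1)⁻¹ * ((carlitzD F p.2)⁻¹ *
          (theta F ^ Fintype.card F ^ p.2 - theta F)) ^ Fintype.card F ^ p.1 -
        ((carlitzL F p.1)⁻¹ * (theta F - theta F ^ Fintype.card F ^ p.1)) *
          (carlitzD F p.2)⁻¹ ^ Fintype.card F ^ p.1 := by
      intro p hp
      rw [← mem_antidiagonal.1 hp, mul_pow, sub_pow_card_pow, ← pow_mul, ← pow_add, add_comm p.2]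
      ring
    -- The end terms split off, with second index `0` in the one sum and first index `0` in the
    -- other, both contain the factor `θ - θ = 0`.
    rw [Finset.mul_sum, Finset.sum_congr rfl key, Finset.sum_sub_distrib,
      Finset.Nat.sum_antidiagonal_succ', Finset.Nat.sum_antidiagonal_succ]
    simp only [inv_carlitzD_succ_mul, hL, pow_zero, pow_one, sub_self, mul_zero, zero_mul, zero_add,
      ← pow_mul, ← pow_succ']
    rw [zero_pow (pow_ne_zero _ Fintype.card_ne_zero), mul_zero, zero_add, sub_self]

theorem logZ_expZ {s : ℕ} (f : PowerSeries (MvPolynomial (Fin s) (RatFunc F))) :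
    logZ (expZ f) = f := by
  rw [expZ_eq_twistedOp, logZ_eq_twistedOp, twistedOp_comp,
    _root_.funext sum_inv_carlitzL_mul_inv_carlitzD, twistedOp_single, one_smul]

/-! ### The action of `K[t₁, …, t_s][[z]]` on `X₁ ⋯ X_s Z` -/

/-- The map `f ↦ f . P` as a `K`-linear map. -/
def actLinear {s : ℕ} (P : MvPolynomial (Fin s) (RatFunc F)) :
    MvPolynomial (Fin s) (RatFunc F) →ₗ[RatFunc F] MvPolynomial (Fin s) (RatFunc F) :=
  (MvPolynomial.basisMonomials (Fin s) (RatFunc F)).constr (RatFunc F)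
    fun i => MvPolynomial.aeval (fun j => carlitzVar (X ^ i j) j) P

theorem actLinear_apply {s : ℕ} (f P : MvPolynomial (Fin s) (RatFunc F)) :
    actLinear P f = act f P := by
  rw [actLinear, Module.Basis.constr_apply]
  rfl

theorem actLinear_monomial {s : ℕ} (P : MvPolynomial (Fin s) (RatFunc F)) (i : Fin s →₀ ℕ) :
    actLinear P (MvPolynomial.monomial i 1) =
      MvPolynomial.aeval (fun j => carlitzVar (X ^ i j) j) P := by
  have h := (MvPolynomial.basisMonomials (Fin s) (RatFunc F)).constr_basis (RatFunc F)
    (fun i => MvPolynomial.aeval (fun j : Fin s => carlitzVar (X ^ i j : F[X]) j) P) i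
  rwa [MvPolynomial.coe_basisMonomials] at h

variable (F) in
/-- The `K`-linear map `K[t] → K[X₁, …, X_s]` that sends `tⁿ` to `C_{θⁿ}(Xⱼ)`. -/
def carlitzVarLinear {s : ℕ} (j : Fin s) :
    (RatFunc F)[X] →ₗ[RatFunc F] MvPolynomial (Fin s) (RatFunc F) :=
  (Polynomial.basisMonomials (RatFunc F)).constr (RatFunc F) fun n => carlitzVar (X ^ n) j

theorem carlitzVarLinear_X_pow {s : ℕ} (j : Fin s) (n : ℕ) :
    carlitzVarLinear F j (X ^ n) = carlitzVar (X ^ n) j := by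
  have h := (Polynomial.basisMonomials (RatFunc F)).constr_basis (RatFunc F)
    (fun n => carlitzVar (X ^ n : F[X]) j) n
  rw [Polynomial.coe_basisMonomials] at h
  rw [← Polynomial.monomial_one_right_eq_X_pow n]
  exact h

/-- Both sides are multilinear in the `g j`, so it is enough to compare them on powers of the
variable, where the action is given by definition. -/
theorem actLinear_prod {s : ℕ} (g : Fin s → (RatFunc F)[X]) :
    actLinear (∏ j, MvPolynomial.X j)
      (∏ j, Polynomial.aeval (MvPolynomial.X j : MvPolynomial (Fin s) (RatFunc F)) (g j)) =
      ∏ j, carlitzVarLinear F j (g j) := by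
  have h : (actLinear (∏ j, MvPolynomial.X j)).compMultilinearMap
      ((MultilinearMap.mkPiAlgebra (RatFunc F) (Fin s) _).compLinearMap fun j =>
        (Polynomial.aeval (MvPolynomial.X j : MvPolynomial (Fin s) (RatFunc F))).toLinearMap) =
      (MultilinearMap.mkPiAlgebra (RatFunc F) (Fin s) _).compLinearMap
        fun j => carlitzVarLinear F j := by
    refine Module.Basis.ext_multilinear (fun _ => Polynomial.basisMonomials (RatFunc F)) fun i => ?_
    have hi : ∏ j, (MvPolynomial.X j : MvPolynomial (Fin s) (RatFunc F)) ^ i j =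
        MvPolynomial.monomial (Finsupp.equivFunOnFinite.symm i) 1 := by
      rw [MvPolynomial.monomial_eq, Finsupp.prod_fintype _ _ (by simp)]
      simp
    simp [Polynomial.monomial_one_right_eq_X_pow, carlitzVarLinear_X_pow, hi, actLinear_monomial]
  exact congrArg (fun m => m g) h

/-- With `actLinear_prod`, this makes `a(t₁) ⋯ a(t_s)` act on `X₁ ⋯ X_s` as `C_a(X₁) ⋯ C_a(X_s)`. -/
theorem carlitzVar_eq_carlitzVarLinear {s : ℕ} (a : F[X]) (j : Fin s) :
    carlitzVar a j = carlitzVarLinear F j (a.map (algebraMap F (RatFunc F))) := by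
  induction a using Polynomial.induction_on' with
  | add a b ha hb => simp only [carlitzVar, map_add, LinearMap.add_apply, Polynomial.map_add] at *
                     rw [ha, hb]
  | monomial n c =>
    rw [Polynomial.map_monomial, ← mul_one (algebraMap F (RatFunc F) c), ← smul_eq_mul,
      ← Polynomial.smul_monomial, map_smul, Polynomial.monomial_one_right_eq_X_pow,
      carlitzVarLinear_X_pow, ← mul_one c, ← smul_eq_mul, ← Polynomial.smul_monomial,
      Polynomial.monomial_one_right_eq_X_pow, carlitzVar, map_smul, smul_eq_mul, mul_one,
      algebraMap_smul]
    rfl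

theorem carlitzVar_X_pow_succ {s : ℕ} (n : ℕ) (j : Fin s) :
    carlitzVar (X ^ (n + 1) : F[X]) j =
      theta F • carlitzVar (X ^ n) j + carlitzVar (X ^ n) j ^ Fintype.card F := by
  rw [carlitzVar, pow_succ', map_mul, Module.End.mul_apply]
  simp [carlitz, carlitzVar, theta, MvPolynomial.smul_eq_C_mul]

/-- `τ_z` on the coefficients corresponds to raising to the power `q`. -/
theorem actLinear_tau {s : ℕ} (f : MvPolynomial (Fin s) (RatFunc F)) :
    actLinear (∏ j, MvPolynomial.X j)
      ((∏ j, (MvPolynomial.X j - MvPolynomial.C (theta F))) * coeffFrob s f) =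
      actLinear (∏ j, MvPolynomial.X j) f ^ Fintype.card F := by
  induction f using MvPolynomial.induction_on' with
  | add f g hf hg => 
    have := add_pow_card_pow (F := F) (actLinear (∏ j, MvPolynomial.X j) f)
      (actLinear (∏ j, MvPolynomial.X j) g) 1
    simp only [pow_one] at this
    rw [map_add, map_add, mul_add, map_add, hf, hg, this]
  | monomial i c =>
    have h1 : coeffFrob s (MvPolynomial.monomial i c) =
        c ^ Fintype.card F • MvPolynomial.monomial i 1 := by
      simp [coeffFrob, MvPolynomial.smul_monomial]
    -- On a monomial the variables separate. The factor `(t_j - θ) t_j^i` acts on `X_j` as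
    -- `C_{θ^(i+1)}(X_j) - θ C_{θ^i}(X_j)`, which is `C_{θ^i}(X_j)^q`.
    have h2 : (∏ j, (MvPolynomial.X j - MvPolynomial.C (theta F))) *
        MvPolynomial.monomial i 1 = ∏ j, Polynomial.aeval
          (MvPolynomial.X j : MvPolynomial (Fin s) (RatFunc F))
          (X ^ (i j + 1) - theta F • X ^ i j : (RatFunc F)[X]) := by
      rw [MvPolynomial.monomial_eq, Finsupp.prod_fintype _ _ (by simp), map_one, one_mul,
        ← Finset.prod_mul_distrib]
      refine Finset.prod_congr rfl fun j _ => ?_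
      simp [MvPolynomial.smul_eq_C_mul]
      ring
    have h3 : MvPolynomial.monomial i c = c • MvPolynomial.monomial i 1 := by
      simp [MvPolynomial.smul_monomial]
    rw [h1, mul_smul_comm, map_smul, h2, actLinear_prod, h3, map_smul, _root_.smul_pow,
      actLinear_monomial, map_prod, ← Finset.prod_pow]
    congr 1
    refine Finset.prod_congr rfl fun j _ => ?_
    rw [map_sub, map_smul, carlitzVarLinear_X_pow, carlitzVarLinear_X_pow, carlitzVar_X_pow_succ,
      MvPolynomial.aeval_X, add_sub_cancel_left]

theorem actLinear_twist {s : ℕ} (i : ℕ) (f : MvPolynomial (Fin s) (RatFunc F)) :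
    actLinear (∏ j, MvPolynomial.X j) (twist F s i * (coeffFrob s)^[i] f) =
      actLinear (∏ j, MvPolynomial.X j) f ^ Fintype.card F ^ i := by
  induction i with
  | zero => simp [twist]
  | succ i ih =>
    rw [pow_succ, pow_mul, ← ih, ← actLinear_tau, map_mul (coeffFrob s), ← mul_assoc,
      ← Function.iterate_succ_apply' (coeffFrob s), add_comm i 1, ← coeffFrob_iterate_twist_mul,
      add_comm 1 i]
    simp [twist]

/-- As `q^j` is a power of the characteristic, raising to it applies Frobenius to the coefficients
and substitutes `Z^(q^j)` for `Z`. -/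
theorem coeff_pow_card_pow_eq {R : Type*} [CommRing R] [Algebra F R] [Nontrivial R]
    (G : PowerSeries R) (j m : ℕ) : PowerSeries.coeff m (G ^ Fintype.card F ^ j) =
      if Fintype.card F ^ j ∣ m then
        PowerSeries.coeff (m / Fintype.card F ^ j) G ^ Fintype.card F ^ j else 0 := by
  obtain ⟨p, hp⟩ := CharP.exists F
  obtain ⟨e, hprime, he⟩ := FiniteField.card F p
  have := Fact.mk hprime
  have : CharP R p := charP_of_injective_algebraMap (algebraMap F R).injective p
  have hq : Fintype.card F ^ j = p ^ (e * j : ℕ) := by rw [he, pow_mul]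
  have h : PowerSeries.map (iterateFrobenius R p (e * j))
      (PowerSeries.expand (p ^ (e * j : ℕ)) (pow_ne_zero _ hprime.ne_zero) G) =
      G ^ p ^ (e * j : ℕ) :=
    MvPowerSeries.map_iterateFrobenius_expand (R := R) p hprime.ne_zero G (e * j)
  rw [hq, ← h, PowerSeries.coeff_map, PowerSeries.coeff_expand, apply_ite (iterateFrobenius R p _),
    map_zero, iterateFrobenius_def]

theorem coeff_actZ_monomialXZ {s : ℕ} (f : PowerSeries (MvPolynomial (Fin s) (RatFunc F)))
    (k : ℕ) : PowerSeries.coeff (Fintype.card F ^ k) (actZ f (monomialXZ F s)) =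
      actLinear (∏ j, MvPolynomial.X j) (PowerSeries.coeff k f) := by
  rw [actZ, formalSum, PowerSeries.coeff_mk, finsum_eq_single _ (k, 1)]
  · simp [monomialXZ, actLinear_apply]
  · rintro ⟨k', n⟩ hne
    rw [PowerSeries.coeff_monomial]
    split_ifs with h
    · by_cases hn : n = 1
      · subst hn
        rw [one_mul] at h
        have := Nat.pow_right_injective Fintype.one_lt_card h
        exact absurd (by rw [this]) hne
      · rw [monomialXZ, PowerSeries.coeff_C_mul, PowerSeries.coeff_X, if_neg hn]
        simp [act]
    · rfl

theorem coeff_actZ_monomialXZ_eq_zero {s : ℕ}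
    (f : PowerSeries (MvPolynomial (Fin s) (RatFunc F))) {m : ℕ}
    (hm : ∀ k, m ≠ Fintype.card F ^ k) : PowerSeries.coeff m (actZ f (monomialXZ F s)) = 0 := by
  rw [actZ, formalSum, PowerSeries.coeff_mk]
  refine finsum_eq_zero_of_forall_eq_zero fun kn => ?_
  rw [PowerSeries.coeff_monomial]
  split_ifs with h
  · by_cases hn : kn.2 = 1
    · rw [hn, one_mul] at h
      exact absurd h (hm _)
    · rw [monomialXZ, PowerSeries.coeff_C_mul, PowerSeries.coeff_X, if_neg hn]
      simp [act]
  · rfl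

/-- The action on `X₁ ⋯ X_s Z` intertwines `∑ⱼ αⱼ τ_zʲ` with `G ↦ ∑ⱼ αⱼ G^(q^j)`. -/
theorem formalSum_pow_actZ_monomialXZ {s : ℕ} (α : ℕ → RatFunc F)
    (f : PowerSeries (MvPolynomial (Fin s) (RatFunc F))) :
    (formalSum fun j : ℕ => α j • actZ f (monomialXZ F s) ^ Fintype.card F ^ j) =
      actZ (twistedOp α f) (monomialXZ F s) := by
  have hq : 0 < Fintype.card F := Fintype.card_pos
  ext1 m
  rw [formalSum, PowerSeries.coeff_mk]
  simp only [PowerSeries.coeff_smul, coeff_pow_card_pow_eq]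
  by_cases hm : ∃ k, m = Fintype.card F ^ k
  · obtain ⟨k, rfl⟩ := hm
    rw [coeff_actZ_monomialXZ, coeff_twistedOp, map_sum,
      Finset.Nat.sum_antidiagonal_eq_sum_range_succ_mk,
      finsum_eq_sum_of_support_subset (s := Finset.range (k + 1))]
    · refine Finset.sum_congr rfl fun i hi => ?_
      have hik : i ≤ k := Nat.lt_succ_iff.1 (Finset.mem_range.1 hi)
      rw [if_pos (pow_dvd_pow _ hik), Nat.pow_div hik hq, coeff_actZ_monomialXZ, map_smul,
        actLinear_twist]
    · intro i hi
      by_contra h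
      have hik : k < i := by simpa using h
      refine hi ?_
      change α i • ite _ _ _ = 0
      rw [if_neg, smul_zero]
      rw [Nat.pow_dvd_pow_iff_le_right Fintype.one_lt_card]
      omega
  · push Not at hm
    rw [coeff_actZ_monomialXZ_eq_zero _ hm]
    refine finsum_eq_zero_of_forall_eq_zero fun i => ?_
    split_ifs with h
    · obtain ⟨n, rfl⟩ := h
      rw [Nat.mul_div_cancel_left _ (pow_pos hq i), coeff_actZ_monomialXZ_eq_zero,
        zero_pow (pow_pos hq i).ne', smul_zero]
      rintro k rfl
      exact hm (i + k) (pow_add _ _ _).symm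
    · rw [smul_zero]

/-! ### The images of `L(1, s, z)` and `σ_s` under the action -/

theorem mem_monicOfDegree {d : ℕ} {a : F[X]} :
    a ∈ monicOfDegree F d ↔ a.Monic ∧ a.natDegree = d := by
  simp [monicOfDegree]

theorem actLinear_coeff_LSeriesZ (s d : ℕ) :
    actLinear (∏ j, MvPolynomial.X j) (PowerSeries.coeff d (LSeriesZ F 1 s)) =
      ∑ a ∈ monicOfDegree F d, (algebraMap F[X] (RatFunc F) a)⁻¹ • ∏ j, carlitzVar a j := by
  rw [LSeriesZ, PowerSeries.coeff_mk, map_sum]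
  refine Finset.sum_congr rfl fun a _ => ?_
  have h : ∀ j : Fin s, Polynomial.aeval (MvPolynomial.X j : MvPolynomial (Fin s) (RatFunc F)) a =
      Polynomial.aeval (MvPolynomial.X j : MvPolynomial (Fin s) (RatFunc F))
        (a.map (algebraMap F (RatFunc F))) := fun j => (Polynomial.aeval_map_algebraMap _ _ _).symm
  simp only [h, map_smul, actLinear_prod, carlitzVar_eq_carlitzVarLinear, zpow_one]

/-- Grouping `l(X₁ ⋯ X_s, Z)` by degree: exactly the monic `a` of degree `k` contribute to
`Z^(q^k)`. -/
theorem actZ_LSeriesZ_monomialXZ (s : ℕ) :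
    actZ (LSeriesZ F 1 s) (monomialXZ F s) = lSeries (∏ j : Fin s, MvPolynomial.X j) := by
  ext1 m
  rw [lSeries, formalSum, PowerSeries.coeff_mk]
  simp only [PowerSeries.coeff_smul, star_C_mul_X, PowerSeries.coeff_C_mul, PowerSeries.coeff_X_pow]
  by_cases hm : ∃ k, m = Fintype.card F ^ k
  · obtain ⟨k, rfl⟩ := hm
    have hk : ∀ n, Fintype.card F ^ k = Fintype.card F ^ n ↔ n = k := fun n =>
      (Nat.pow_right_injective Fintype.one_lt_card).eq_iff.trans eq_comm
    rw [coeff_actZ_monomialXZ, actLinear_coeff_LSeriesZ]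
    classical
    rw [finsum_eq_sum_of_support_subset (s := (monicOfDegree F k).subtype Polynomial.Monic)]
    · rw [Finset.sum_subtype_of_mem (fun a : F[X] => (algebraMap F[X] (RatFunc F) a)⁻¹ •
        (MvPolynomial.aeval (carlitzVar a) (∏ j : Fin s, MvPolynomial.X j) *
          if Fintype.card F ^ k = Fintype.card F ^ a.natDegree then 1 else 0))
        fun a ha => (mem_monicOfDegree.1 ha).1]
      refine Finset.sum_congr rfl fun a ha => ?_
      rw [if_pos ((hk _).2 (mem_monicOfDegree.1 ha).2), mul_one, map_prod]
      simp only [MvPolynomial.aeval_X]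
    · intro a ha
      rw [Finset.mem_coe, Finset.mem_subtype, mem_monicOfDegree]
      refine ⟨a.2, ?_⟩
      by_contra hne
      refine ha ?_
      change _ • (_ * ite _ _ _) = 0
      rw [if_neg fun h => hne ((hk _).1 h), mul_zero, smul_zero]
  · push Not at hm
    rw [coeff_actZ_monomialXZ_eq_zero _ hm]
    refine (finsum_eq_zero_of_forall_eq_zero fun a => ?_).symm
    rw [if_neg (hm _), mul_zero, smul_zero]

theorem actZ_sigma_monomialXZ (s : ℕ) : actZ (sigma F s) (monomialXZ F s) = specialS F s := by
  rw [specialS, frakL, ← actZ_LSeriesZ_monomialXZ, expC, formalSum_pow_actZ_monomialXZ]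
  rfl

theorem actZ_LSeriesZ_eq_logC_specialS (s : ℕ) :
    actZ (LSeriesZ F 1 s) (monomialXZ F s) = logC (specialS F s) := by
  rw [← actZ_sigma_monomialXZ, logC, formalSum_pow_actZ_monomialXZ, ← logZ_eq_twistedOp, sigma,
    logZ_expZ]

/-! ### Divisibility by an irreducible polynomial -/

theorem dvd_X_pow_card_pow_sub_X_iff {P : F[X]} (hP : Irreducible P) {n : ℕ} :
    P ∣ X ^ Fintype.card F ^ n - X ↔ P.natDegree ∣ n := by
  rw [hP.natDegree_dvd_iff_dvd_X_pow_card_pow_sub_X, Nat.card_eq_fintype_card]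

/-- Fermat's little theorem in `A/P`: the `q^d`-power map is an `F`-algebra endomorphism fixing the
generator `θ`, hence the identity. -/
theorem dvd_pow_card_pow_natDegree_sub_self {P : F[X]} (hP : Irreducible P) (a : F[X]) :
    P ∣ a ^ Fintype.card F ^ P.natDegree - a := by
  have h : (FiniteField.frobeniusAlgHom F (F[X] ⧸ Ideal.span {P}) ^ P.natDegree).comp
      (Ideal.Quotient.mkₐ F (Ideal.span {P})) = Ideal.Quotient.mkₐ F (Ideal.span {P}) := by
    refine Polynomial.algHom_ext ?_
    rw [AlgHom.comp_apply, frobeniusAlgHom_pow_apply, ← map_pow, ← sub_eq_zero, ← map_sub,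
      Ideal.Quotient.mkₐ_eq_mk, Ideal.Quotient.eq_zero_iff_dvd]
    exact (dvd_X_pow_card_pow_sub_X_iff hP).2 dvd_rfl
  have h2 := DFunLike.congr_fun h a
  rwa [AlgHom.comp_apply, frobeniusAlgHom_pow_apply, ← map_pow, ← sub_eq_zero, ← map_sub,
    Ideal.Quotient.mkₐ_eq_mk, Ideal.Quotient.eq_zero_iff_dvd] at h2

/-- `X^(q^n) - X` is separable, hence squarefree, so `P` divides it at most once. -/
theorem exists_X_pow_card_pow_sub_X_eq {P : F[X]} (hP : Irreducible P) {n : ℕ} (hn : n ≠ 0) :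
    ∃ e u, e ≤ 1 ∧ ¬ P ∣ u ∧ X ^ Fintype.card F ^ n - X = P ^ e * u := by
  obtain ⟨p, hp⟩ := CharP.exists F
  obtain ⟨m, hprime, he⟩ := FiniteField.card F p
  have hdvd : p ∣ Fintype.card F ^ n := by
    rw [he]
    exact dvd_pow (dvd_pow_self p m.pos.ne') hn
  have hsq := (galois_poly_separable (K := F) p _ hdvd).squarefree
  by_cases h : P ∣ X ^ Fintype.card F ^ n - X
  · obtain ⟨u, hu⟩ := h
    refine ⟨1, u, le_rfl, ?_, by rw [pow_one, hu]⟩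
    rintro ⟨v, rfl⟩
    exact hP.not_isUnit (hsq P ⟨v, by rw [hu, mul_assoc]⟩)
  · exact ⟨0, _, zero_le_one, h, by simp⟩

/-- The strict bound on `e` is the point, and it passes through the recursion: `1 + q (q^j - 1) <
q^(j+1)`. -/
theorem exists_carlitzD_eq {P : F[X]} (hP : Irreducible P) (j : ℕ) :
    ∃ e u, e < Fintype.card F ^ j ∧ ¬ P ∣ u ∧
      carlitzD F j = algebraMap F[X] (RatFunc F) (P ^ e * u) := by
  induction j with
  | zero => exact ⟨0, 1, by simp, fun h => hP.not_isUnit (isUnit_of_dvd_one h), by simp [carlitzD]⟩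
  | succ j ih =>
    obtain ⟨e, u, he, hu, h⟩ := ih
    obtain ⟨e', u', he', hu', h'⟩ := exists_X_pow_card_pow_sub_X_eq (F := F) hP j.succ_ne_zero
    refine ⟨e' + e * Fintype.card F, u' * u ^ Fintype.card F, ?_, ?_, ?_⟩
    · have hq : 1 < Fintype.card F := Fintype.one_lt_card
      have : (e + 1) * Fintype.card F ≤ Fintype.card F ^ j * Fintype.card F :=
        Nat.mul_le_mul_right _ he
      rw [pow_succ]
      linarith
    · exact fun hd => (hP.prime.dvd_or_dvd hd).elim hu' fun hd => hu (hP.prime.dvd_of_dvd_pow hd)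
    · have hx : theta F ^ Fintype.card F ^ (j + 1) - theta F =
          algebraMap F[X] (RatFunc F) (X ^ Fintype.card F ^ (j + 1) - X) := by
        simp [theta]
      rw [carlitzD, h, hx, h', ← map_pow, ← map_mul]
      congr 1
      ring

/-- Over `A/P`, the roots of `P` are the `d` distinct Frobenius conjugates of the class of `θ`. -/
theorem prod_X_sub_C_X_pow_card_pow {P : F[X]} (hP : Irreducible P) (hm : P.Monic) :
    C P ∣ (∏ k ∈ Finset.range P.natDegree, (X - C (X ^ Fintype.card F ^ k)) : F[X][X]) -
      P.map C := by
  set B := F[X] ⧸ Ideal.span {P}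
  have hprime : (Ideal.span {P}).IsPrime := (Ideal.span_singleton_prime hP.ne_zero).2 hP.prime
  let mk : F[X] →ₐ[F] B := Ideal.Quotient.mkₐ F (Ideal.span {P})
  have hmk : ∀ a, mk a = 0 ↔ P ∣ a := fun a => Ideal.Quotient.eq_zero_iff_dvd _ _
  have hpow : ∀ (x : B) k, Polynomial.aeval (x ^ Fintype.card F ^ k) P =
      Polynomial.aeval x P ^ Fintype.card F ^ k := fun x k => by
    rw [← frobeniusAlgHom_pow_apply, ← frobeniusAlgHom_pow_apply, Polynomial.aeval_algHom_apply]
  have hroot : Polynomial.aeval (mk X) P = 0 := by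
    rw [Polynomial.aeval_algHom_apply, Polynomial.aeval_X_left_apply, hmk]
  -- If two conjugates coincide, extracting a `q^k`-th root in the domain `A/P` gives `P ∣ X^(q^r) -
  -- X` with `0 < r < d`, which is impossible.
  have hinj : Set.InjOn (fun k => mk X ^ Fintype.card F ^ k) (Finset.range P.natDegree) := by
    have : ∀ k l, k < l → l < P.natDegree →
        mk X ^ Fintype.card F ^ k ≠ mk X ^ Fintype.card F ^ l := by
      intro k l hkl hl h
      obtain ⟨m, rfl⟩ := Nat.exists_eq_add_of_lt hkl
      rw [add_assoc, add_comm k, pow_add _ _ k, pow_mul, eq_comm, ← sub_eq_zero,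
        ← sub_pow_card_pow, pow_eq_zero_iff (pow_ne_zero _ Fintype.card_ne_zero), ← map_pow,
        ← map_sub, hmk, dvd_X_pow_card_pow_sub_X_iff hP] at h
      have := Nat.le_of_dvd m.succ_pos h
      omega
    intro k hk l hl h
    simp only [Finset.coe_range, Set.mem_Iio] at hk hl
    rcases lt_trichotomy k l with hkl | hkl | hkl
    · exact absurd h (this k l hkl hl)
    · exact hkl
    · exact absurd h.symm (this l k hkl hk)
  have key : ∏ k ∈ Finset.range P.natDegree, (X - C (mk X ^ Fintype.card F ^ k)) =
      P.map (algebraMap F B) := by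
    have hW : (∏ k ∈ Finset.range P.natDegree, (X - C (mk X ^ Fintype.card F ^ k))).Monic :=
      monic_prod_of_monic _ _ fun k _ => monic_X_sub_C _
    have hdeg : (∏ k ∈ Finset.range P.natDegree, (X - C (mk X ^ Fintype.card F ^ k))).degree =
        ((P.natDegree : ℕ) : WithBot ℕ) := by
      simp only [degree_prod, degree_X_sub_C, Finset.sum_const, Finset.card_range, nsmul_one]
    -- The difference of two monic polynomials of degree `d` has degree below `d`, and here it
    -- vanishes at `d` distinct points.
    refine eq_of_degree_sub_lt_of_eval_index_eq _ hinj ?_ fun k hk => ?_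
    · rw [Finset.card_range, ← hdeg]
      refine degree_sub_lt_left ?_ hW.ne_zero ?_
      · rw [hdeg, hm.degree_map, degree_eq_natDegree hP.ne_zero]
      · rw [hW.leadingCoeff, (hm.map _).leadingCoeff]
    · rw [eval_map_algebraMap, hpow, hroot, zero_pow (pow_ne_zero _ Fintype.card_ne_zero),
        eval_prod, Finset.prod_eq_zero hk]
      simp
  rw [Polynomial.C_dvd_iff_dvd_coeff]
  intro n
  have hmap : Polynomial.map mk.toRingHom ((∏ k ∈ Finset.range P.natDegree,
      (X - C (X ^ Fintype.card F ^ k)) : F[X][X]) - P.map C) = 0 := by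
    rw [Polynomial.map_sub, Polynomial.map_prod, sub_eq_zero, Polynomial.map_map]
    have hC : mk.toRingHom.comp C = algebraMap F B := RingHom.ext fun c => mk.commutes c
    rw [hC, ← key]
    simp
  rw [← hmk]
  simpa using congrArg (fun f => Polynomial.coeff f n) hmap

/-! ### The coefficients of the Carlitz module -/

variable (F) in
/-- The coefficient of `τᵏ` in `C_{θⁱ}`. -/
def carlitzCoeffXPow : ℕ → ℕ → F[X]
  | 0, 0 => 1
  | 0, _ + 1 => 0
  | i + 1, 0 => X * carlitzCoeffXPow i 0
  | i + 1, k + 1 => X * carlitzCoeffXPow i (k + 1) + carlitzCoeffXPow i k ^ Fintype.card F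

variable (F) in
/-- The coefficient of `τᵏ` in `C_a`. -/
def carlitzCoeff (k : ℕ) : F[X] →ₗ[F] F[X] :=
  (Polynomial.basisMonomials F).constr F fun i => carlitzCoeffXPow F i k

theorem carlitzCoeff_apply (k : ℕ) (a : F[X]) :
    carlitzCoeff F k a = a.sum fun i c => c • carlitzCoeffXPow F i k := by
  rw [carlitzCoeff, Module.Basis.constr_apply]
  rfl

theorem carlitzCoeff_monomial (k i : ℕ) (c : F) :
    carlitzCoeff F k (monomial i c) = c • carlitzCoeffXPow F i k := by
  rw [carlitzCoeff_apply, Polynomial.sum_monomial_index _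
    (fun i c => c • carlitzCoeffXPow F i k) (zero_smul _ _)]

theorem carlitzCoeffXPow_zero (i : ℕ) : carlitzCoeffXPow F i 0 = X ^ i := by
  induction i with
  | zero => rfl
  | succ i ih => rw [carlitzCoeffXPow, ih, pow_succ']

theorem carlitzCoeffXPow_of_lt {i k : ℕ} (h : i < k) : carlitzCoeffXPow F i k = 0 := by
  induction i generalizing k with
  | zero => obtain ⟨k, rfl⟩ := Nat.exists_eq_succ_of_ne_zero h.ne'; rfl
  | succ i ih =>
    obtain ⟨k, rfl⟩ := Nat.exists_eq_succ_of_ne_zero (Nat.ne_zero_of_lt h)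
    rw [carlitzCoeffXPow, ih (by omega), ih (by omega), zero_pow Fintype.card_ne_zero, mul_zero,
      add_zero]

theorem carlitzCoeffXPow_self (i : ℕ) : carlitzCoeffXPow F i i = 1 := by
  induction i with
  | zero => rfl
  | succ i ih =>
    rw [carlitzCoeffXPow, ih, carlitzCoeffXPow_of_lt (Nat.lt_succ_self i), one_pow, mul_zero,
      zero_add]

/-- This is the coefficient of `τ^(k+1)` in `C_θ C_{θ^i} = C_{θ^i} C_θ`. The defining recursion
multiplies by `C_θ` on the left only, so the commutation is recovered by induction on `i`. -/
theorem carlitzCoeffXPow_mul (i k : ℕ) :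
    carlitzCoeffXPow F i (k + 1) * (X ^ Fintype.card F ^ (k + 1) - X) =
      carlitzCoeffXPow F i k ^ Fintype.card F - carlitzCoeffXPow F i k := by
  have hadd := fun x y : F[X] => add_pow_card_pow (F := F) x y 1
  have hsub := fun x y : F[X] => sub_pow_card_pow (F := F) x y 1
  simp only [pow_one] at hadd hsub
  induction i generalizing k with
  | zero => cases k <;> simp [carlitzCoeffXPow, Fintype.card_ne_zero]
  | succ i ih =>
    rw [carlitzCoeffXPow, add_mul, mul_assoc, ih]
    cases k with
    | zero =>
      simp only [carlitzCoeffXPow, mul_pow, zero_add, pow_one]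
      ring
    | succ k =>
      have h := congrArg (· ^ Fintype.card F) (ih k)
      simp only [mul_pow, hsub, ← pow_mul, ← pow_succ] at h
      rw [carlitzCoeffXPow, hadd, mul_pow]
      linear_combination h

theorem carlitzCoeff_zero (a : F[X]) : carlitzCoeff F 0 a = a := by
  induction a using Polynomial.induction_on' with
  | add a b ha hb => rw [map_add, ha, hb]
  | monomial n c => rw [carlitzCoeff_monomial, carlitzCoeffXPow_zero, smul_X_eq_monomial]

theorem carlitzCoeff_mul (k : ℕ) (a : F[X]) :
    carlitzCoeff F (k + 1) a * (X ^ Fintype.card F ^ (k + 1) - X) =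
      carlitzCoeff F k a ^ Fintype.card F - carlitzCoeff F k a := by
  induction a using Polynomial.induction_on' with
  | add a b ha hb =>
    have hadd := fun x y : F[X] => add_pow_card_pow (F := F) x y 1
    simp only [pow_one] at hadd
    rw [map_add, map_add, add_mul, ha, hb, hadd]
    ring
  | monomial n c =>
    rw [carlitzCoeff_monomial, carlitzCoeff_monomial, smul_mul_assoc, carlitzCoeffXPow_mul,
      _root_.smul_pow, FiniteField.pow_card, smul_sub]

theorem carlitzCoeff_of_natDegree_lt {k : ℕ} {a : F[X]} (h : a.natDegree < k) :
    carlitzCoeff F k a = 0 := by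
  rw [carlitzCoeff_apply, Polynomial.sum_over_range (f := fun i c => c • carlitzCoeffXPow F i _) _
    (fun _ => zero_smul _ _)]
  refine Finset.sum_eq_zero fun i hi => ?_
  rw [carlitzCoeffXPow_of_lt (by rw [Finset.mem_range] at hi; omega), smul_zero]

theorem carlitzCoeff_natDegree {a : F[X]} (h : a.Monic) : carlitzCoeff F a.natDegree a = 1 := by
  rw [carlitzCoeff_apply, Polynomial.sum_over_range (f := fun i c => c • carlitzCoeffXPow F i _) _
    (fun _ => zero_smul _ _),
    Finset.sum_range_succ, Finset.sum_eq_zero, zero_add, carlitzCoeffXPow_self, coeff_natDegree,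
    h.leadingCoeff, one_smul]
  intro i hi
  rw [carlitzCoeffXPow_of_lt (Finset.mem_range.1 hi), smul_zero]

/-- Together with `carlitzCoeff_natDegree`, this says `C_P ≡ τ^d` modulo `P`. Starting from the
constant coefficient `P`, `carlitzCoeff_mul` propagates divisibility as long as `P` does not divide
`X^(q^k) - X`, that is, for `0 < k < d`. -/
theorem dvd_carlitzCoeff {P : F[X]} (hP : Irreducible P) {k : ℕ} (hk : k ≠ P.natDegree) :
    P ∣ carlitzCoeff F k P := by
  rcases hk.lt_or_gt with h | h
  · induction k with
    | zero => rw [carlitzCoeff_zero]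
    | succ k ih =>
      have hd : P ∣ carlitzCoeff F (k + 1) P * (X ^ Fintype.card F ^ (k + 1) - X) := by
        rw [carlitzCoeff_mul]
        have := ih (by omega) (by omega)
        exact dvd_sub (dvd_pow this Fintype.card_ne_zero) this
      refine (hP.prime.dvd_or_dvd hd).resolve_right fun h2 => ?_
      exact absurd (Nat.le_of_dvd k.succ_pos ((dvd_X_pow_card_pow_sub_X_iff hP).1 h2)) (by omega)
  · rw [carlitzCoeff_of_natDegree_lt h]
    exact dvd_zero _

/-! ### The functional equation of the Carlitz exponential -/

theorem sum_carlitzCoeffXPow_mul_inv_carlitzD (i n : ℕ) :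
    ∑ p ∈ antidiagonal n, algebraMap F[X] (RatFunc F) (carlitzCoeffXPow F i p.1) *
      (carlitzD F p.2)⁻¹ ^ Fintype.card F ^ p.1 =
      (carlitzD F n)⁻¹ * (theta F ^ i) ^ Fintype.card F ^ n := by
  induction i generalizing n with
  | zero =>
    rw [Finset.sum_eq_single (0, n)]
    · simp [carlitzCoeffXPow]
    · rintro ⟨a, b⟩ h hne
      simp only [mem_antidiagonal] at h
      have : 0 < a := by
        rw [Nat.pos_iff_ne_zero]
        rintro rfl
        exact hne (by simpa using h)
      simp [carlitzCoeffXPow_of_lt this]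
    · simp
  | succ i ih =>
    cases n with
    | zero => simp [carlitzCoeffXPow_zero, carlitzD, theta]
    | succ n =>
      -- The recursion for `C_{θ^(i+1)}` splits the sum into `θ` times the sum for `(i, n + 1)` and
      -- the `q`-th power of the sum for `(i, n)`; the recursion of `D` then combines the two.
      have hs := sum_pow_card_pow (F := F) (antidiagonal n) (fun p =>
        algebraMap F[X] (RatFunc F) (carlitzCoeffXPow F i p.1) *
          (carlitzD F p.2)⁻¹ ^ Fintype.card F ^ p.1) 1
      have h1 := ih (n + 1)
      rw [Finset.Nat.sum_antidiagonal_succ] at h1 ⊢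
      simp only [ih n, pow_one, mul_pow, ← pow_mul, ← pow_succ] at hs
      simp only [carlitzCoeffXPow, map_add, map_mul, map_pow, add_mul, Finset.sum_add_distrib,
        mul_assoc, ← Finset.mul_sum, ← hs]
      rw [← add_assoc, ← mul_add, h1, ← inv_carlitzD_succ_mul, theta]
      ring

theorem sum_carlitzCoeff_mul_inv_carlitzD (a : F[X]) (n : ℕ) :
    ∑ p ∈ antidiagonal n, algebraMap F[X] (RatFunc F) (carlitzCoeff F p.1 a) *
      (carlitzD F p.2)⁻¹ ^ Fintype.card F ^ p.1 =
      (carlitzD F n)⁻¹ * algebraMap F[X] (RatFunc F) a ^ Fintype.card F ^ n := by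
  induction a using Polynomial.induction_on' with
  | add a b ha hb =>
    simp only [map_add, add_mul, Finset.sum_add_distrib, ha, hb, add_pow_card_pow (F := F), mul_add]
  | monomial i c =>
    have hc : (monomial i c : F[X]) = c • X ^ i := by rw [smul_X_eq_monomial]
    have hs : ∀ x : F[X], algebraMap F[X] (RatFunc F) (c • x) =
        c • algebraMap F[X] (RatFunc F) x := fun x => by
      rw [Algebra.smul_def, map_mul, Algebra.smul_def, ← IsScalarTower.algebraMap_apply]
    simp only [carlitzCoeff_monomial, hs, smul_mul_assoc, ← Finset.smul_sum,
      sum_carlitzCoeffXPow_mul_inv_carlitzD]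
    rw [hc, hs, _root_.smul_pow, FiniteField.pow_card_pow, mul_smul_comm, map_pow, theta]

/-- The functional equation `exp_z ∘ a = C_a(τ_z) ∘ exp_z`. -/
theorem expZ_smul {s : ℕ} (a : F[X]) (f : PowerSeries (MvPolynomial (Fin s) (RatFunc F))) :
    expZ (algebraMap F[X] (RatFunc F) a • f) =
      twistedOp (fun k => algebraMap F[X] (RatFunc F) (carlitzCoeff F k a)) (expZ f) := by
  rw [expZ_eq_twistedOp, expZ_eq_twistedOp, twistedOp_comp,
    _root_.funext (sum_carlitzCoeff_mul_inv_carlitzD a), ← twistedOp_single, twistedOp_comp]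
  congr 1
  ext1 n
  rw [Finset.sum_eq_single (n, 0)]
  · simp
  · rintro ⟨x, y⟩ h hne
    simp only [mem_antidiagonal] at h
    have : y ≠ 0 := by
      rintro rfl
      exact hne (by simpa using h)
    simp [this]
  · simp

/-! ### Integrality of `σ_s` at an irreducible polynomial -/

theorem exists_pow_card_pow_sub_self_eq {P : F[X]} (hP : Irreducible P) {x : RatFunc F}
    (hx : x ∈ localSubring hP) : ∃ y ∈ localSubring hP,
      x ^ Fintype.card F ^ P.natDegree - x = algebraMap F[X] (RatFunc F) P * y := by
  obtain ⟨a, b, hb, h⟩ := hx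
  set Q := Fintype.card F ^ P.natDegree
  have hP0 : algebraMap F[X] (RatFunc F) P ≠ 0 :=
    RatFunc.algebraMap_ne_zero hP.ne_zero
  -- The expression equals `(a^Q - a) b - a (b^Q - b)`, and Fermat applies to numerator and
  -- denominator separately.
  have hd : P ∣ a ^ Q * b - a * b ^ Q := by
    have h1 := (dvd_pow_card_pow_natDegree_sub_self hP a).mul_right b
    have h2 := (dvd_pow_card_pow_natDegree_sub_self hP b).mul_left a
    have := dvd_sub h1 h2
    ring_nf at this ⊢
    exact this
  obtain ⟨e, he⟩ := hd
  refine ⟨(x ^ Q - x) / algebraMap F[X] (RatFunc F) P, ⟨e, b ^ Q * b, ?_, ?_⟩, ?_⟩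
  · exact fun hd => (hP.prime.dvd_or_dvd hd).elim (fun hd => hb (hP.prime.dvd_of_dvd_pow hd)) hb
  · have h3 : algebraMap F[X] (RatFunc F) P * algebraMap F[X] (RatFunc F) e =
        (x ^ Q - x) * algebraMap F[X] (RatFunc F) (b ^ Q * b) := by
      rw [← map_mul, ← he, map_sub, map_mul, map_mul, map_mul, map_pow, map_pow, ← h]
      ring
    rw [div_mul_eq_mul_div, div_eq_iff hP0, ← h3, mul_comm]
  · rw [mul_div_cancel₀ _ hP0]

/-- The exponent of `P` in `D_j` is less than `q^j`, so at least one factor `P` survives the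
division. This lets `exp_z` preserve multiples of `P`. -/
theorem exists_inv_carlitzD_mul_pow_eq {P : F[X]} (hP : Irreducible P) (j : ℕ) :
    ∃ y ∈ localSubring hP, (carlitzD F j)⁻¹ * algebraMap F[X] (RatFunc F) P ^ Fintype.card F ^ j =
      algebraMap F[X] (RatFunc F) P * y := by
  obtain ⟨e, u, he, hu, h⟩ := exists_carlitzD_eq hP j
  obtain ⟨m, hm⟩ := Nat.exists_eq_add_of_lt he
  have hP0 : algebraMap F[X] (RatFunc F) P ≠ 0 :=
    RatFunc.algebraMap_ne_zero hP.ne_zero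
  refine ⟨algebraMap F[X] (RatFunc F) (P ^ m) * (algebraMap F[X] (RatFunc F) u)⁻¹,
    mul_mem (algebraMap_mem_localSubring hP _) (inv_mem_localSubring hP hu), ?_⟩
  rw [h, hm, map_mul, map_pow, map_pow, mul_inv, add_assoc, pow_add, pow_succ]
  have : algebraMap F[X] (RatFunc F) P ^ e ≠ 0 := pow_ne_zero _ hP0
  field_simp

theorem coeff_coeffFrob_iterate {s : ℕ} (i : ℕ) (f : MvPolynomial (Fin s) (RatFunc F))
    (m : Fin s →₀ ℕ) : MvPolynomial.coeff m ((coeffFrob s)^[i] f) =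
      MvPolynomial.coeff m f ^ Fintype.card F ^ i := by
  induction i with
  | zero => simp
  | succ i ih =>
    rw [Function.iterate_succ_apply', coeffFrob, MvPolynomial.coeff_map, ← coeffFrob, ih, pow_succ,
      pow_mul]
    rfl

theorem coeffFrob_iterate_mem_localPolynomials {P : F[X]} (hP : Irreducible P) {s : ℕ} (i : ℕ)
    {f : MvPolynomial (Fin s) (RatFunc F)} (hf : f ∈ localPolynomials hP s) :
    (coeffFrob s)^[i] f ∈ localPolynomials hP s := by
  rw [mem_localPolynomials] at hf ⊢
  intro m
  rw [coeff_coeffFrob_iterate]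
  exact pow_mem (hf m) _

theorem twist_mem_localPolynomials {P : F[X]} (hP : Irreducible P) (s i : ℕ) :
    twist F s i ∈ localPolynomials hP s :=
  prod_mem fun _ _ => prod_mem fun j _ => sub_mem (X_mem_localPolynomials hP j)
    (C_mem_localPolynomials hP (pow_mem (algebraMap_mem_localSubring hP _) _))

theorem coeffFrob_iterate_natDegree_sub_self_mem {P : F[X]} (hP : Irreducible P) {s : ℕ}
    {f : MvPolynomial (Fin s) (RatFunc F)} (hf : f ∈ localPolynomials hP s) :
    (coeffFrob s)^[P.natDegree] f - f ∈ localMultiples hP s := by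
  refine mem_localMultiples_of_coeff hP fun m => ?_
  rw [MvPolynomial.coeff_sub, coeff_coeffFrob_iterate]
  exact exists_pow_card_pow_sub_self_eq hP ((mem_localPolynomials hP).1 hf m)

theorem twist_natDegree_sub_prod_mem {P : F[X]} (hP : Irreducible P) (hm : P.Monic) (s : ℕ) :
    twist F s P.natDegree - ∏ j : Fin s,
      Polynomial.aeval (MvPolynomial.X j : MvPolynomial (Fin s) (RatFunc F)) P ∈
        localMultiples hP s := by
  rw [twist, Finset.prod_comm]
  refine prod_sub_prod_mem_localMultiples hP _ (fun j _ => prod_mem fun k _ =>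
    sub_mem (X_mem_localPolynomials hP j) (C_mem_localPolynomials hP
      (pow_mem (algebraMap_mem_localSubring hP _) _)))
    (fun j _ => aeval_X_mem_localPolynomials hP j P) fun j _ => ?_
  obtain ⟨g, hg⟩ := prod_X_sub_C_X_pow_card_pow hP hm
  let ev : F[X][X] →+* MvPolynomial (Fin s) (RatFunc F) :=
    Polynomial.eval₂RingHom (MvPolynomial.C.comp (algebraMap F[X] (RatFunc F))) (MvPolynomial.X j)
  have hev := congrArg ev hg
  have hev_g : ev g ∈ localPolynomials hP s := by
    simp only [ev, Polynomial.coe_eval₂RingHom]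
    rw [Polynomial.eval₂_eq_sum_range]
    exact sum_mem fun i _ => mul_mem (C_mem_localPolynomials hP (algebraMap_mem_localSubring hP _))
      (pow_mem (X_mem_localPolynomials hP j) _)
  refine ⟨ev g, hev_g, ?_⟩
  simp only [ev, map_sub, map_prod, map_mul, Polynomial.coe_eval₂RingHom, Polynomial.eval₂_X,
    Polynomial.eval₂_C, Polynomial.eval₂_map, RingHom.comp_apply, map_pow] at hev
  change algebraMap F[X] (RatFunc F) P • ev g = _
  rw [MvPolynomial.smul_eq_C_mul]
  simp only [map_pow]
  exact hev.symm

/-! ### The congruence modulo `P` satisfied by `L(1, s, z)` and `σ_s` -/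

theorem coeffFrob_prod_aeval_X {s : ℕ} (a : F[X]) (i : ℕ) :
    (coeffFrob s)^[i] (∏ j : Fin s,
      Polynomial.aeval (MvPolynomial.X j : MvPolynomial (Fin s) (RatFunc F)) a) =
      ∏ j : Fin s, Polynomial.aeval (MvPolynomial.X j : MvPolynomial (Fin s) (RatFunc F)) a := by
  refine Function.iterate_fixed ?_ i
  rw [map_prod]
  refine Finset.prod_congr rfl fun j _ => ?_
  rw [Polynomial.aeval_def, Polynomial.hom_eval₂, coeffFrob_X]
  congr 1
  ext c
  rw [RingHom.comp_apply, IsScalarTower.algebraMap_apply F (RatFunc F) (MvPolynomial _ _),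
    MvPolynomial.algebraMap_eq, coeffFrob_C, ← map_pow, FiniteField.pow_card]

/-- `τ_z` commutes with multiplication by `z^d g` when `φ` fixes `g`. -/
theorem twistedOp_X_pow_mul {s : ℕ} (α : ℕ → RatFunc F) (d : ℕ)
    {g : MvPolynomial (Fin s) (RatFunc F)} (hg : coeffFrob s g = g)
    (f : PowerSeries (MvPolynomial (Fin s) (RatFunc F))) :
    twistedOp α (PowerSeries.X ^ d * (PowerSeries.C g * f)) =
      PowerSeries.X ^ d * (PowerSeries.C g * twistedOp α f) := by
  have h : ∀ j, tauZ^[j] (PowerSeries.X ^ d * (PowerSeries.C g * f)) =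
      PowerSeries.X ^ d * (PowerSeries.C g * tauZ^[j] f) := by
    intro j
    induction j with
    | zero => rfl
    | succ j ih =>
      rw [Function.iterate_succ_apply', Function.iterate_succ_apply', ih, tauZ, tauZ]
      simp only [map_mul, map_pow, PowerSeries.map_X, PowerSeries.map_C, hg]
      ring
  ext1 n
  simp only [twistedOp, formalSum, h, PowerSeries.coeff_mk, PowerSeries.coeff_X_pow_mul',
    PowerSeries.coeff_smul, PowerSeries.coeff_C_mul]
  split_ifs with hd
  · rw [mul_finsum]
    simp only [mul_smul_comm]
  · simp

/-- The part of `P L(1, s, z)` that is summed over the multiples of `P` is `z^d P(t₁) ⋯ P(t_s)`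
times `L(1, s, z)`, where `d` is the degree of `P`. -/
theorem coeff_smul_LSeriesZ_sub_mem {P : F[X]} (hP : Irreducible P) (hm : P.Monic) (s n : ℕ) :
    PowerSeries.coeff n (algebraMap F[X] (RatFunc F) P • LSeriesZ F 1 s -
      PowerSeries.X ^ P.natDegree * (PowerSeries.C (∏ j : Fin s,
        Polynomial.aeval (MvPolynomial.X j : MvPolynomial (Fin s) (RatFunc F)) P) *
          LSeriesZ F 1 s)) ∈ localMultiples hP s := by
  classical
  have hP0 : algebraMap F[X] (RatFunc F) P ≠ 0 :=
    RatFunc.algebraMap_ne_zero hP.ne_zero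
  have h : ∑ a ∈ (monicOfDegree F n).filter (P ∣ ·), algebraMap F[X] (RatFunc F) P •
      (algebraMap F[X] (RatFunc F) a ^ (1 : ℤ))⁻¹ • ∏ j : Fin s, Polynomial.aeval
        (MvPolynomial.X j : MvPolynomial (Fin s) (RatFunc F)) a =
      PowerSeries.coeff n (PowerSeries.X ^ P.natDegree * (PowerSeries.C (∏ j : Fin s,
        Polynomial.aeval (MvPolynomial.X j : MvPolynomial (Fin s) (RatFunc F)) P) *
          LSeriesZ F 1 s)) := by
    rw [PowerSeries.coeff_X_pow_mul', PowerSeries.coeff_C_mul, LSeriesZ, PowerSeries.coeff_mk]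
    split_ifs with hd
    · rw [Finset.mul_sum]
      refine (Finset.sum_bij (fun b _ => P * b) ?_ ?_ ?_ ?_).symm
      · intro b hb
        rw [mem_monicOfDegree] at hb
        rw [Finset.mem_filter, mem_monicOfDegree]
        exact ⟨⟨hm.mul hb.1, by rw [hm.natDegree_mul hb.1, hb.2, Nat.add_sub_cancel' hd]⟩,
          dvd_mul_right _ _⟩
      · exact fun b _ b' _ hbb => mul_left_cancel₀ hP.ne_zero hbb
      · intro a ha
        rw [Finset.mem_filter, mem_monicOfDegree] at ha
        obtain ⟨⟨ha, hn⟩, b, rfl⟩ := ha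
        have hb := hm.of_mul_monic_left ha
        refine ⟨b, ?_, rfl⟩
        rw [mem_monicOfDegree, ← hn, hm.natDegree_mul hb]
        exact ⟨hb, by omega⟩
      · intro b _
        simp only [zpow_one, map_mul, Finset.prod_mul_distrib, mul_inv, smul_smul]
        rw [mul_inv_cancel_left₀ hP0, mul_smul_comm]
    · refine Finset.sum_eq_zero fun a ha => ?_
      rw [Finset.mem_filter, mem_monicOfDegree] at ha
      exact absurd (ha.1.2 ▸ natDegree_le_of_dvd ha.2 ha.1.1.ne_zero) hd
  -- What remains is `P` times the sum over the `a` prime to `P`, whose inverses are integral at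
  -- `P`.
  rw [map_sub, ← h, PowerSeries.coeff_smul, LSeriesZ, PowerSeries.coeff_mk, Finset.smul_sum,
    ← Finset.sum_filter_add_sum_filter_not _ (P ∣ ·), add_sub_cancel_left, ← Finset.smul_sum,
    smul_mem_localMultiples_iff]
  refine sum_mem fun a ha => smul_mem_localPolynomials hP ?_
    (prod_mem fun j _ => aeval_X_mem_localPolynomials hP j a)
  rw [zpow_one]
  exact inv_mem_localSubring hP (Finset.mem_filter.1 ha).2

theorem coeff_expZ_mem_localMultiples {P : F[X]} (hP : Irreducible P) {s : ℕ}
    {f : PowerSeries (MvPolynomial (Fin s) (RatFunc F))}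
    (hf : ∀ n, PowerSeries.coeff n f ∈ localMultiples hP s) (n : ℕ) :
    PowerSeries.coeff n (expZ f) ∈ localMultiples hP s := by
  rw [expZ_eq_twistedOp, coeff_twistedOp]
  refine sum_mem fun p _ => ?_
  obtain ⟨g, hg, h⟩ := (mem_localMultiples hP).1 (hf p.2)
  obtain ⟨y, hy, h2⟩ := exists_inv_carlitzD_mul_pow_eq hP p.1
  rw [← h, coeffFrob_iterate_smul, mul_smul_comm, smul_smul, h2, mul_smul,
    smul_mem_localMultiples_iff]
  exact smul_mem_localPolynomials hP hy (mul_mem (twist_mem_localPolynomials hP s _)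
    (coeffFrob_iterate_mem_localPolynomials hP _ hg))

theorem coeff_sigma_mem_localPolynomials {P : F[X]} (hP : Irreducible P) (hm : P.Monic)
    (s n : ℕ) : PowerSeries.coeff n (sigma F s) ∈ localPolynomials hP s := by
  induction n using Nat.strong_induction_on with
  | _ n ih =>
    set PT := ∏ j : Fin s,
      Polynomial.aeval (MvPolynomial.X j : MvPolynomial (Fin s) (RatFunc F)) P with hPT
    have hPTmem : PT ∈ localPolynomials hP s :=
      prod_mem fun j _ => aeval_X_mem_localPolynomials hP j P
    have hd0 : 0 < P.natDegree := hP.natDegree_pos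
    -- Applying `exp_z` to the congruence for `P L` gives `C_P(τ_z) σ ≡ z^d P(t₁) ⋯ P(t_s) σ` modulo
    -- `P`. The term of index `0`, which is `P σ_n`, is then set apart.
    have hmain := coeff_expZ_mem_localMultiples hP (coeff_smul_LSeriesZ_sub_mem hP hm s) n
    rw [expZ_eq_twistedOp, twistedOp_sub, twistedOp_X_pow_mul _ _ (coeffFrob_prod_aeval_X P 1),
      ← expZ_eq_twistedOp, ← expZ_eq_twistedOp, expZ_smul, ← sigma, map_sub, coeff_twistedOp,
      ← Finset.add_sum_erase _ _ (show (0, n) ∈ antidiagonal n by simp), ← hPT] at hmain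
    -- All other terms involve only `σ_m` with `m < n`, integral by induction: the term of index `d`
    -- is congruent to `P(t₁) ⋯ P(t_s) σ_(n-d)`, and the rest vanish modulo `P`.
    have hterm : ∀ p ∈ (antidiagonal n).erase (0, n),
        (algebraMap F[X] (RatFunc F) (carlitzCoeff F p.1 P) •
          (twist F s p.1 * (coeffFrob s)^[p.1] (PowerSeries.coeff p.2 (sigma F s)))) -
        (if p.1 = P.natDegree then PT * PowerSeries.coeff p.2 (sigma F s) else 0) ∈
          localMultiples hP s := by
      rintro ⟨k, m⟩ hp
      simp only [Finset.mem_erase, mem_antidiagonal] at hp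
      obtain ⟨hne, rfl⟩ := hp
      have hk : k ≠ 0 := by
        rintro rfl
        simp at hne
      have hσ := ih m (by omega)
      dsimp only
      split_ifs with hkd
      · subst hkd
        rw [carlitzCoeff_natDegree hm, map_one, one_smul]
        have h1 := mul_mem_localMultiples hP
          (coeffFrob_iterate_mem_localPolynomials hP P.natDegree hσ)
          (twist_natDegree_sub_prod_mem hP hm s)
        have h2 := mul_mem_localMultiples hP hPTmem
          (coeffFrob_iterate_natDegree_sub_self_mem hP hσ)
        convert add_mem h1 h2 using 1
        ring
      · obtain ⟨c, hc⟩ := dvd_carlitzCoeff hP hkd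
        rw [sub_zero, hc, map_mul, mul_smul, smul_mem_localMultiples_iff]
        exact smul_mem_localPolynomials hP (algebraMap_mem_localSubring hP c)
          (mul_mem (twist_mem_localPolynomials hP s _)
            (coeffFrob_iterate_mem_localPolynomials hP _ hσ))
    have hsum := sum_mem hterm
    have hite : ∑ p ∈ (antidiagonal n).erase (0, n),
        (if p.1 = P.natDegree then PT * PowerSeries.coeff p.2 (sigma F s) else 0) =
        PowerSeries.coeff n (PowerSeries.X ^ P.natDegree * (PowerSeries.C PT * sigma F s)) := by
      rw [PowerSeries.coeff_X_pow_mul', PowerSeries.coeff_C_mul]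
      split_ifs with hdn
      · rw [Finset.sum_eq_single (P.natDegree, n - P.natDegree), if_pos rfl]
        · rintro ⟨k, m⟩ hp hne
          simp only [Finset.mem_erase, mem_antidiagonal] at hp
          refine if_neg fun hk => hne ?_
          dsimp only at hk
          rw [Prod.mk.injEq]
          omega
        · intro hp
          refine absurd ?_ hp
          rw [Finset.mem_erase, mem_antidiagonal]
          refine ⟨fun h => ?_, Nat.add_sub_cancel' hdn⟩
          rw [Prod.mk.injEq] at h
          omega
      · refine Finset.sum_eq_zero fun p hp => if_neg fun hk => hdn ?_
        rw [Finset.mem_erase, mem_antidiagonal] at hp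
        omega
    -- The difference of the two congruences is exactly `P σ_n`; cancelling `P` gives integrality of
    -- `σ_n`.
    rw [Finset.sum_sub_distrib, hite] at hsum
    have hfin := sub_mem hmain hsum
    rw [← smul_mem_localMultiples_iff]
    convert hfin using 1
    simp only [carlitzCoeff_zero, Function.iterate_zero, id_eq, twist, Finset.range_zero,
      Finset.prod_empty, one_mul]
    abel

theorem coeff_sigma_mem_range (s n : ℕ) : PowerSeries.coeff n (sigma F s) ∈
    (MvPolynomial.map (σ := Fin s) (algebraMap F[X] (RatFunc F))).range := by
  rw [mem_range_map_iff]
  exact fun m => mem_range_of_forall_mem_localSubring fun P hP hm =>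
    (mem_localPolynomials hP).1 (coeff_sigma_mem_localPolynomials hP hm s n) m

/-! ### The degree in `θ` of the coefficients of `σ_s` -/

open scoped Classical in
theorem inftyValuation_carlitzD (j : ℕ) : RatFunc.inftyValuation F (carlitzD F j) =
    WithZero.exp ((j : ℤ) * (Fintype.card F : ℤ) ^ j) := by
  induction j with
  | zero => simp [carlitzD]
  | succ j ih =>
    have hx : theta F ^ Fintype.card F ^ (j + 1) - theta F =
        algebraMap F[X] (RatFunc F) (X ^ Fintype.card F ^ (j + 1) - X) := by
      simp [theta]
    rw [carlitzD, map_mul, map_pow, ih, hx, inftyValuation_algebraMap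
      (FiniteField.X_pow_card_pow_sub_X_ne_zero F j.succ_ne_zero Fintype.one_lt_card),
      FiniteField.X_pow_card_pow_sub_X_natDegree_eq F j.succ_ne_zero Fintype.one_lt_card,
      ← WithZero.exp_nsmul, ← WithZero.exp_add]
    congr 1
    push_cast
    rw [nsmul_eq_mul, Nat.succ_eq_add_one]
    ring

theorem twist_mem_degreeAtMost (s i : ℕ) :
    twist F s i ∈ degreeAtMost F s ((s : ℤ) * ((Fintype.card F : ℤ) ^ i - 1)) := by
  classical
  have hk : ∀ k ∈ Finset.range i, ∏ j : Fin s,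
      (MvPolynomial.X j - MvPolynomial.C (theta F ^ Fintype.card F ^ k)) ∈
        degreeAtMost F s ((s : ℤ) * (Fintype.card F : ℤ) ^ k) := by
    intro k _
    have hj : ∀ j ∈ (Finset.univ : Finset (Fin s)),
        MvPolynomial.X j - MvPolynomial.C (theta F ^ Fintype.card F ^ k) ∈
          degreeAtMost F s ((Fintype.card F : ℤ) ^ k) := by
      intro j _
      refine sub_mem (degreeAtMost_mono (by positivity) (X_mem_degreeAtMost j))
        (C_mem_degreeAtMost ?_)
      rw [theta, ← map_pow, inftyValuation_algebraMap (pow_ne_zero _ X_ne_zero), natDegree_X_pow]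
      push_cast
      rfl
    simpa using prod_mem_degreeAtMost _ hj
  refine degreeAtMost_mono ?_ (prod_mem_degreeAtMost _ hk)
  rw [← Finset.mul_sum]
  -- The crude bound `1 + q + ⋯ + q^(i-1) ≤ q^i - 1`, an equality for `q = 2`, avoids dividing by `q
  -- - 1` and is sufficient.
  refine mul_le_mul_of_nonneg_left ?_ (by positivity)
  have hq : (2 : ℤ) ≤ Fintype.card F := by exact_mod_cast (Fintype.one_lt_card : 1 < Fintype.card F)
  induction i with
  | zero => simp
  | succ i ih =>
    rw [Finset.sum_range_succ, pow_succ]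
    have := ih fun k hk' => hk k (Finset.mem_range.2 (by rw [Finset.mem_range] at hk'; omega))
    nlinarith [pow_pos (show (0 : ℤ) < Fintype.card F by omega) i]

theorem coeffFrob_iterate_mem_degreeAtMost {s : ℕ} (i : ℕ) {n : ℤ}
    {f : MvPolynomial (Fin s) (RatFunc F)} (hf : f ∈ degreeAtMost F s n) :
    (coeffFrob s)^[i] f ∈ degreeAtMost F s ((Fintype.card F : ℤ) ^ i * n) := by
  intro m
  rw [coeff_coeffFrob_iterate, map_pow]
  refine (pow_le_pow_left' (hf m) _).trans_eq ?_
  rw [← WithZero.exp_nsmul, nsmul_eq_mul]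
  push_cast
  rfl

theorem coeff_LSeriesZ_mem_degreeAtMost (s n : ℕ) :
    PowerSeries.coeff n (LSeriesZ F 1 s) ∈ degreeAtMost F s (-n) := by
  classical
  rw [LSeriesZ, PowerSeries.coeff_mk]
  refine sum_mem fun a ha => ?_
  rw [mem_monicOfDegree] at ha
  rw [zpow_one, MvPolynomial.smul_eq_C_mul, ← add_zero (-(n : ℤ))]
  refine mul_mem_degreeAtMost (C_mem_degreeAtMost ?_) ?_
  · rw [map_inv₀, inftyValuation_algebraMap ha.1.ne_zero, ha.2, WithZero.exp_neg]
  · have h : ∀ j ∈ (Finset.univ : Finset (Fin s)), Polynomial.aeval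
        (MvPolynomial.X j : MvPolynomial (Fin s) (RatFunc F)) a ∈ degreeAtMost F s 0 := by
      intro j _
      rw [Polynomial.aeval_eq_sum_range]
      refine sum_mem fun i _ => ?_
      have hX : (MvPolynomial.X j : MvPolynomial (Fin s) (RatFunc F)) ^ i ∈
          degreeAtMost F s 0 := by
        simpa using prod_mem_degreeAtMost (Finset.range i) (n := fun _ => 0)
          fun _ _ => X_mem_degreeAtMost j
      rw [Algebra.smul_def, IsScalarTower.algebraMap_apply F (RatFunc F) (MvPolynomial _ _),
        ← add_zero (0 : ℤ)]
      refine mul_mem_degreeAtMost (C_mem_degreeAtMost ?_) hX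
      rw [IsScalarTower.algebraMap_apply F F[X] (RatFunc F), Polynomial.algebraMap_eq]
      by_cases hc : a.coeff i = 0
      · simp [hc]
      · rw [inftyValuation_algebraMap (C_ne_zero.2 hc), natDegree_C]
        simp
    simpa using prod_mem_degreeAtMost _ h

/-- The term with indices `i + m = n` has degree at most `-i q^i + s (q^i - 1) - m q^i = (s - n) q^i
- s`, hence at most `-s ≤ -1` once `n ≥ s`. -/
theorem coeff_sigma_mem_degreeAtMost {s n : ℕ} (hs : 1 ≤ s) (hn : s ≤ n) :
    PowerSeries.coeff n (sigma F s) ∈ degreeAtMost F s (-1) := by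
  classical
  rw [sigma, expZ_eq_twistedOp, coeff_twistedOp]
  refine sum_mem fun p hp => ?_
  rw [mem_antidiagonal] at hp
  rw [MvPolynomial.smul_eq_C_mul]
  have h1 : (MvPolynomial.C (carlitzD F p.1)⁻¹ : MvPolynomial (Fin s) (RatFunc F)) ∈
      degreeAtMost F s (-((p.1 : ℤ) * (Fintype.card F : ℤ) ^ p.1)) := by
    refine C_mem_degreeAtMost ?_
    rw [map_inv₀, inftyValuation_carlitzD, WithZero.exp_neg]
  refine degreeAtMost_mono ?_ (mul_mem_degreeAtMost h1 (mul_mem_degreeAtMost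
    (twist_mem_degreeAtMost s p.1) (coeffFrob_iterate_mem_degreeAtMost p.1
      (coeff_LSeriesZ_mem_degreeAtMost s p.2))))
  have h2 : (s : ℤ) ≤ p.1 + p.2 := by exact_mod_cast hp ▸ hn
  have h3 : (1 : ℤ) ≤ s := by exact_mod_cast hs
  have h4 : (0 : ℤ) ≤ (Fintype.card F : ℤ) ^ p.1 := by positivity
  nlinarith [mul_le_mul_of_nonneg_right h2 h4]

theorem coeff_sigma_eq_zero {s n : ℕ} (hs : 1 ≤ s) (hn : s ≤ n) :
    PowerSeries.coeff n (sigma F s) = 0 := by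
  classical
  ext m
  have h1 := coeff_sigma_mem_degreeAtMost (F := F) hs hn m
  obtain ⟨a, ha⟩ := (mem_range_map_iff _).1 (coeff_sigma_mem_range (F := F) s n) m
  rw [← ha] at h1 ⊢
  by_cases ha0 : a = 0
  · rw [ha0, map_zero, MvPolynomial.coeff_zero]
  · rw [inftyValuation_algebraMap ha0, WithZero.exp_le_exp] at h1
    omega

/-! ### Integrality -/

theorem isIntegralPolynomial_sigma {s : ℕ} (hs : 1 ≤ s) : IsIntegralPolynomial (sigma F s) :=
  isIntegralPolynomial_of_coeff s (coeff_sigma_mem_range s) fun _ hn => coeff_sigma_eq_zero hs hn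

theorem carlitzVar_X_pow_mem_range {s : ℕ} (n : ℕ) (j : Fin s) : carlitzVar (X ^ n : F[X]) j ∈
    (MvPolynomial.map (σ := Fin s) (algebraMap F[X] (RatFunc F))).range := by
  induction n with
  | zero =>
    rw [pow_zero, carlitzVar, map_one]
    exact ⟨MvPolynomial.X j, by simp⟩
  | succ n ih =>
    rw [carlitzVar_X_pow_succ, MvPolynomial.smul_eq_C_mul]
    exact add_mem (mul_mem ⟨MvPolynomial.C X, by simp [theta]⟩ ih) (pow_mem ih _)

theorem actLinear_mem_range {s : ℕ} {f : MvPolynomial (Fin s) (RatFunc F)}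
    (hf : f ∈ (MvPolynomial.map (σ := Fin s) (algebraMap F[X] (RatFunc F))).range) :
    actLinear (∏ j, MvPolynomial.X j) f ∈
      (MvPolynomial.map (σ := Fin s) (algebraMap F[X] (RatFunc F))).range := by
  rw [actLinear_apply, act]
  refine sum_mem fun i _ => ?_
  obtain ⟨c, hc⟩ := (mem_range_map_iff _).1 hf i
  rw [← hc, MvPolynomial.smul_eq_C_mul, map_prod]
  refine mul_mem ⟨MvPolynomial.C c, by simp⟩ (prod_mem fun j _ => ?_)
  rw [MvPolynomial.aeval_X]
  exact carlitzVar_X_pow_mem_range _ j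

theorem isIntegralPolynomial_specialS {s : ℕ} (hs : 1 ≤ s) :
    IsIntegralPolynomial (specialS F s) := by
  rw [← actZ_sigma_monomialXZ]
  -- Only exponents `q^k` of `Z` occur, and `σ_s` has no coefficient in degree `k ≥ s`; hence the
  -- bound `q^s`.
  refine isIntegralPolynomial_of_coeff (Fintype.card F ^ s) (fun m => ?_) fun m hm => ?_
  · by_cases h : ∃ k, m = Fintype.card F ^ k
    · obtain ⟨k, rfl⟩ := h
      rw [coeff_actZ_monomialXZ]
      exact actLinear_mem_range (coeff_sigma_mem_range s k)
    · push Not at h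
      rw [coeff_actZ_monomialXZ_eq_zero _ h]
      exact zero_mem _
  · by_cases h : ∃ k, m = Fintype.card F ^ k
    · obtain ⟨k, rfl⟩ := h
      rw [coeff_actZ_monomialXZ, coeff_sigma_eq_zero hs, map_zero]
      exact (Nat.pow_le_pow_iff_right Fintype.one_lt_card).1 hm
    · push Not at h
      exact coeff_actZ_monomialXZ_eq_zero _ h

end AndersonStark

end

theorem mainTheorem2 {F : Type*} [Field F] [Fintype F] (s : ℕ) (hs : 1 ≤ s) :
    -- `L(1, s, z) = log_z(σ_s)`
    AndersonStark.LSeriesZ F 1 s = AndersonStark.logZ (AndersonStark.sigma F s) ∧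
    -- `L(1, s, z) . (X₁ ⋯ X_s Z) = l(X₁ ⋯ X_s, Z) = log_C(𝕊_s)`
    AndersonStark.actZ (AndersonStark.LSeriesZ F 1 s) (AndersonStark.monomialXZ F s) =
      AndersonStark.lSeries (∏ j : Fin s, MvPolynomial.X j) ∧
    AndersonStark.actZ (AndersonStark.LSeriesZ F 1 s) (AndersonStark.monomialXZ F s) =
      AndersonStark.logC (AndersonStark.specialS F s) ∧
    -- `σ_s . (X₁ ⋯ X_s Z) = 𝕊_s`, with `𝕊_s ∈ A[X₁, …, X_s, Z]`
    AndersonStark.actZ (AndersonStark.sigma F s) (AndersonStark.monomialXZ F s) =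
      AndersonStark.specialS F s ∧
    AndersonStark.IsIntegralPolynomial (AndersonStark.specialS F s) ∧
    -- `σ_s ∈ A[t₁, …, t_s, z]`
    AndersonStark.IsIntegralPolynomial (AndersonStark.sigma F s) := by
  exact ⟨(AndersonStark.logZ_expZ _).symm, AndersonStark.actZ_LSeriesZ_monomialXZ s,
    AndersonStark.actZ_LSeriesZ_eq_logC_specialS s, AndersonStark.actZ_sigma_monomialXZ s,
    AndersonStark.isIntegralPolynomial_specialS hs, AndersonStark.isIntegralPolynomial_sigma hs⟩
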